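/- Let $n$ be a natural number, let $e_{[n]}=(1,\dots,1)\in\mathbb{Z}^n$, let $N=\mathbb{Z}^n/\mathbb{Z}e_{[n]}$ and $N_{\mathbb{R}}=\mathbb{R}\otimes_{\mathbb{Z}}N=\mathbb{R}^n/\mathbb{R}e_{[n]}$. Let $\mathcal{B}(n)$ be the braid arrangement fan in $N_{\mathbb{R}}$: its maximal cones are the Weyl chambers $\{x : x_{\pi(1)}\le x_{\pi(2)}\le\dots\le x_{\pi(n)}\}$, for $\pi$ a permutation of $[n]$, and its cones are all the faces of these. A fan in $N_{\mathbb{R}}$ is a finite collection of strongly convex rational polyhedral cones that contains every face of each of its members and in which any two members intersect in a common face. It is complete if its union is $N_{\mathbb{R}}$, and it is refined by $\mathcal{B}(n)$ if it has the same support as $\mathcal{B}(n)$ and every cone of $\mathcal{B}(n)$ is contained in one of its cones. For a cone $\sigma$ let $\sigma(1)$ be the set of minimal lattice points on its rays; $\sigma$ is smooth if $\sigma(1)$ can be extended to a basis of $N$, and a fan is smooth if all its cones are. For a smooth fan $\Sigma$ and a cone $\tau\in\Sigma$ with $\tau(1)=\{v_1,\dots,v_k\}$, $k\ge 2$, put $v_0=v_1+\dots+v_k$;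 the smooth star subdivision of $\Sigma$ relative to $\tau$ is \[\Sigma^*(\tau)=\{\sigma\in\Sigma:\tau\not\subseteq\sigma\}\cup\bigcup_{\tau\subseteq\sigma\in\Sigma}\{\mathrm{cone}(A): A\subseteq\sigma(1)\cup\{v_0\},\ \tau(1)\not\subseteq A\}.\] Let $\Sigma_1$ and $\Sigma_2$ be two complete smooth fans in $N_{\mathbb{R}}$ which are refined by $\mathcal{B}(n)$. Then there exists a fan $\Sigma_3$ which can be obtained from both $\Sigma_1$ and $\Sigma_2$ by finite (possibly empty) sequences of smooth star subdivisions; that is, Oda's strong factorization conjecture holds for $\Sigma_1$ and $\Sigma_2$. Moreover, $\Sigma_3$ can always be taken to be $\mathcal{B}(n)$. -/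

import Mathlib

namespace ToricFan

section General

variable {V : Type*} [AddCommGroup V] [Module ℝ V]

/-- `σ` is a strongly convex rational polyhedral cone with respect to the lattice `N`: it is
generated by finitely many lattice vectors and it contains no line. -/
def IsRationalCone (N : Submodule ℤ V) (σ : PointedCone ℝ V) : Prop :=
  (∃ s : Finset V, (s : Set V) ⊆ N ∧ σ = PointedCone.hull ℝ (s : Set V)) ∧
    ∀ x ∈ σ, -x ∈ σ → x = 0

/-- A fan: a finite collection of strongly convex rational polyhedral cones, containing every face
of each of its members, any two of which intersect in a common face. -/
structure IsFan (N : Submodule ℤ V) (F : Set (PointedCone ℝ V)) : Prop where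
  finite : F.Finite
  rational : ∀ σ ∈ F, IsRationalCone N σ
  face_mem : ∀ σ ∈ F, ∀ τ : PointedCone ℝ V, τ.IsFaceOf σ → τ ∈ F
  inter_face : ∀ σ ∈ F, ∀ τ ∈ F, (σ ⊓ τ).IsFaceOf σ ∧ (σ ⊓ τ).IsFaceOf τ

/-- `σ(1)`: the minimal lattice points on the rays (one-dimensional faces) of `σ`. -/
def rayGens (N : Submodule ℤ V) (σ : PointedCone ℝ V) : Set V :=
  {v | v ∈ N ∧ v ≠ 0 ∧ (PointedCone.hull ℝ {v}).IsFaceOf σ ∧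
    ∀ t : ℝ, 0 < t → t < 1 → t • v ∉ N}

/-- A cone is smooth if `σ(1)` can be extended to a `ℤ`-basis of the lattice `N`. -/
def IsSmoothCone (N : Submodule ℤ V) (σ : PointedCone ℝ V) : Prop :=
  ∃ B : Set V, rayGens N σ ⊆ B ∧ LinearIndepOn ℤ id B ∧ Submodule.span ℤ B = N

/-- A fan is smooth if each of its cones is. -/
def IsSmooth (N : Submodule ℤ V) (F : Set (PointedCone ℝ V)) : Prop :=
  ∀ σ ∈ F, IsSmoothCone N σ

/-- The support of a fan: the union of its cones. -/
def support (F : Set (PointedCone ℝ V)) : Set V := ⋃ σ ∈ F, (σ : Set V)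

/-- A fan is complete if its support is the whole space. -/
def IsComplete (F : Set (PointedCone ℝ V)) : Prop := support F = Set.univ

/-- `F'` refines `F` (that is, `F` is refined by `F'`): the supports agree, and every cone of `F'`
is contained in a cone of `F`. -/
def Refines (F' F : Set (PointedCone ℝ V)) : Prop :=
  support F' = support F ∧ ∀ σ' ∈ F', ∃ σ ∈ F, σ' ≤ σ

/-- `v₀`: the sum of the minimal ray generators of `τ`. -/
noncomputable def starCenter (N : Submodule ℤ V) (τ : PointedCone ℝ V) : V :=
  ∑ᶠ v ∈ rayGens N τ, v

/-- The star subdivision of the cone `σ` relative to `τ`: all cones `cone(A)` with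
`A ⊆ σ(1) ∪ {v₀}` and `τ(1) ⊄ A`. -/
def coneStarSubdivision (N : Submodule ℤ V) (τ σ : PointedCone ℝ V) : Set (PointedCone ℝ V) :=
  {ρ | ∃ A : Set V, A ⊆ rayGens N σ ∪ {starCenter N τ} ∧ ¬ rayGens N τ ⊆ A ∧
    ρ = PointedCone.hull ℝ A}

/-- The star subdivision of the fan `F` relative to `τ`. -/
def starSubdivision (N : Submodule ℤ V) (F : Set (PointedCone ℝ V)) (τ : PointedCone ℝ V) :
    Set (PointedCone ℝ V) :=
  {σ ∈ F | ¬ τ ≤ σ} ∪ ⋃ σ ∈ {σ ∈ F | τ ≤ σ}, coneStarSubdivision N τ σ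

/-- `F'` is obtained from `F` by one smooth star subdivision: `F` is a smooth fan, and `F'` is its
star subdivision relative to a cone `τ ∈ F` with at least two rays. (The formula for the star
subdivision is not meant for cones with fewer rays: for the zero cone it returns the empty
collection, and for a ray it deletes all the cones containing this ray.) -/
def IsSmoothStarSubdivision (N : Submodule ℤ V) (F F' : Set (PointedCone ℝ V)) : Prop :=
  IsFan N F ∧ IsSmooth N F ∧
    ∃ τ ∈ F, 2 ≤ (rayGens N τ).ncard ∧ F' = starSubdivision N F τ

/-- `F₃` is a fan that can be obtained from both `F₁` and `F₂` by (finite, possibly empty) sequences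
of smooth star subdivisions. -/
def IsStrongFactorization (N : Submodule ℤ V) (F₁ F₂ F₃ : Set (PointedCone ℝ V)) : Prop :=
  IsFan N F₃ ∧ Relation.ReflTransGen (IsSmoothStarSubdivision N) F₁ F₃ ∧
    Relation.ReflTransGen (IsSmoothStarSubdivision N) F₂ F₃

end General

/-- The space `N_ℝ = ℝⁿ / ℝ e_{[n]}`, where `e_{[n]} = (1, …, 1)`. -/
abbrev BraidSpace (n : ℕ) : Type := (Fin n → ℝ) ⧸ Submodule.span ℝ {(1 : Fin n → ℝ)}

/-- The map `ℤⁿ → N_ℝ`, sending an integer vector to its class. -/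
noncomputable def integerClass (n : ℕ) : (Fin n → ℤ) →ₗ[ℤ] BraidSpace n :=
  ((Submodule.span ℝ {(1 : Fin n → ℝ)}).mkQ.restrictScalars ℤ).comp
    ((Int.castAddHom ℝ).toIntLinearMap.compLeft (Fin n))

/-- The lattice `N ⊆ N_ℝ`: the classes of the integer vectors. -/
noncomputable def braidLattice (n : ℕ) : Submodule ℤ (BraidSpace n) :=
  LinearMap.range (integerClass n)

/-- The kernel of `ℤⁿ → N_ℝ` is `ℤ e_{[n]}`, so that `braidLattice n` is `ℤⁿ / ℤ e_{[n]}`. -/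
theorem ker_integerClass (n : ℕ) :
    LinearMap.ker (integerClass n) = Submodule.span ℤ {(1 : Fin n → ℤ)} := by
  ext z
  have h : integerClass n z = (Submodule.span ℝ {(1 : Fin n → ℝ)}).mkQ (fun i => (z i : ℝ)) := rfl
  rw [LinearMap.mem_ker, h, Submodule.mkQ_apply, Submodule.Quotient.mk_eq_zero,
    Submodule.mem_span_singleton, Submodule.mem_span_singleton]
  constructor
  · rintro ⟨a, ha⟩
    rcases isEmpty_or_nonempty (Fin n) with hn | ⟨⟨i₀⟩⟩
    · exact ⟨0, funext fun i => hn.elim i⟩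
    · refine ⟨z i₀, funext fun i => ?_⟩
      have h1 := congrFun ha i
      have h2 := congrFun ha i₀
      simp only [Pi.smul_apply, Pi.one_apply, smul_eq_mul, mul_one] at h1 h2 ⊢
      exact_mod_cast h2.symm.trans h1
  · rintro ⟨a, rfl⟩
    exact ⟨a, funext fun i => by simp⟩

/-- The linear functional `x_j - x_i` on `N_ℝ`. -/
noncomputable def coordDiff {n : ℕ} (i j : Fin n) : BraidSpace n →ₗ[ℝ] ℝ :=
  (Submodule.span ℝ {(1 : Fin n → ℝ)}).liftQ
    ((LinearMap.proj j : (Fin n → ℝ) →ₗ[ℝ] ℝ) - LinearMap.proj i) (by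
      rw [Submodule.span_singleton_le_iff_mem]
      simp)

/-- The (closed) Weyl chamber `x_{π(1)} ≤ x_{π(2)} ≤ ⋯ ≤ x_{π(n)}` of the permutation `π`. -/
noncomputable def weylChamber {n : ℕ} (π : Equiv.Perm (Fin n)) : PointedCone ℝ (BraidSpace n) where
  carrier := {x | ∀ i j : Fin n, i ≤ j → 0 ≤ coordDiff (π i) (π j) x}
  add_mem' := by
    intro x y hx hy i j hij
    rw [map_add]
    exact add_nonneg (hx i j hij) (hy i j hij)
  zero_mem' := by
    intro i j _
    simp
  smul_mem' := by
    intro c x hx i j hij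
    have h : coordDiff (π i) (π j) (c • x) = (c : ℝ) * coordDiff (π i) (π j) x :=
      map_smul (coordDiff (π i) (π j)) (c : ℝ) x
    rw [h]
    exact mul_nonneg c.2 (hx i j hij)

/-- The braid arrangement fan `𝓑(n)`: the Weyl chambers of type `A` and all of their faces. -/
def braidFan (n : ℕ) : Set (PointedCone ℝ (BraidSpace n)) :=
  {σ | ∃ π : Equiv.Perm (Fin n), σ.IsFaceOf (weylChamber π)}

end ToricFan

/-! It suffices to join each of the two fans to the braid fan by star subdivisions. Let `F` be a
smooth fan such that every Weyl chamber lies in one of its cones. A chamber is generated by the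
classes `e_S` of indicator vectors, so every ray of `F` is spanned by some `e_S`
(`exists_eq_indicatorClass`). The relation `e_A + e_C = e_(A∩C) + e_(A∪C)` then forces sets on rays
of a common cone to be nested, disjoint or covering (`nested`).

If no two-dimensional cone of `F` comes from an incomparable pair, the sets of each cone form a
chain, so each cone lies in a chamber and `F` is the braid fan (`eq_braidFan`). Otherwise subdivide
at an incomparable pair `A`, `B` with `|A ∆ B|` maximal. Smoothness survives because replacing `u`
by `u + v` in a lattice basis gives a lattice basis. The new ray is again some `e_T`, namely for the
union or the intersection, so only finitely many steps are possible.

The crux is that the chambers still lie in cones of the new fan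
(`isBraidCoarsening_starSubdivision`). The subdivision cuts a maximal cone along the locus where its
`e_A`- and `e_B`-coordinates agree. By `exists_wall` these coordinates are differences `x_j₁ - x_i₁`
and `x_j₂ - x_i₂`. Maximality of `|A ∆ B|` gives `i₁ = i₂` or `j₁ = j₂` (`eq_of_disjoint`,
`eq_of_union_eq_univ`), so the cut is a hyperplane of the braid arrangement and crosses no chamber.
-/

namespace ToricFan

/-! ### Cones over parts of a lattice basis -/

section Cones

variable {V : Type*} [AddCommGroup V] [Module ℝ V]

theorem sum_mem_hull {s : Set V} {G : Finset V} (hG : (G : Set V) ⊆ s) {c : V → ℝ}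
    (hc : ∀ g ∈ G, 0 ≤ c g) : ∑ g ∈ G, c g • g ∈ PointedCone.hull ℝ s :=
  Submodule.sum_mem _ fun g hg =>
    PointedCone.smul_mem _ (hc g hg) (PointedCone.subset_hull (hG hg))

theorem hull_pair_le {s : PointedCone ℝ V} {u v : V} (hu : u ∈ s) (hv : v ∈ s) :
    PointedCone.hull ℝ {u, v} ≤ s :=
  Submodule.span_le.2 (by rintro x (rfl | rfl) <;> assumption)

theorem mem_hull_singleton {u x : V} :
    x ∈ PointedCone.hull ℝ {u} ↔ ∃ t : ℝ, 0 ≤ t ∧ x = t • u := by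
  rw [Submodule.mem_span_singleton]
  constructor
  · rintro ⟨t, rfl⟩
    exact ⟨t.1, t.2, rfl⟩
  · rintro ⟨t, ht, rfl⟩
    exact ⟨⟨t, ht⟩, rfl⟩

theorem mem_sup_hull_singleton {ρ : PointedCone ℝ V} {w x : V} :
    x ∈ ρ ⊔ PointedCone.hull ℝ {w} ↔ ∃ y ∈ ρ, ∃ t : ℝ, 0 ≤ t ∧ x = y + t • w := by
  rw [Submodule.mem_sup]
  constructor
  · rintro ⟨y, hy, z, hz, rfl⟩
    obtain ⟨t, ht, rfl⟩ := mem_hull_singleton.1 hz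
    exact ⟨y, hy, t, ht, rfl⟩
  · rintro ⟨y, hy, t, ht, rfl⟩
    exact ⟨y, hy, _, mem_hull_singleton.2 ⟨t, ht, rfl⟩, rfl⟩

/-- A family of functionals dual to a linearly independent set. -/
def IsDualFamily (B : Set V) (c : V → V →ₗ[ℝ] ℝ) : Prop :=
  ∀ b ∈ B, c b b = 1 ∧ ∀ b' ∈ B, b' ≠ b → c b b' = 0

theorem exists_isDualFamily {B : Set V} (hB : LinearIndepOn ℝ id B) :
    ∃ c : V → V →ₗ[ℝ] ℝ, IsDualFamily B c := by
  have h : ∀ b : V, ∃ f : V →ₗ[ℝ] ℝ, b ∈ B → f b = 1 ∧ ∀ b' ∈ B, b' ≠ b → f b' = 0 := by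
    intro b
    by_cases hb : b ∈ B
    · have h1 : b ∉ Submodule.span ℝ (B \ {b}) := by
        have := (linearIndepOn_iff_notMem_span.1 hB) b hb
        simpa using this
      obtain ⟨f, hf, hf'⟩ := Submodule.exists_le_ker_of_notMem h1
      refine ⟨(f b)⁻¹ • f, fun _ => ⟨by simp [inv_mul_cancel₀ hf], fun b' hb' hne => ?_⟩⟩
      have : f b' = 0 := hf' (Submodule.subset_span ⟨hb', hne⟩)
      simp [this]
    · exact ⟨0, fun h => absurd h hb⟩
  choose c hc using h
  exact ⟨c, fun b hb => hc b hb⟩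

namespace IsDualFamily

variable {B : Set V} {c : V → V →ₗ[ℝ] ℝ} {G : Finset V} {x : V}

theorem nonneg (h : IsDualFamily B c) (hG : (G : Set V) ⊆ B)
    (hx : x ∈ PointedCone.hull ℝ (G : Set V)) {b : V} (hb : b ∈ B) : 0 ≤ c b x := by
  induction hx using Submodule.span_induction with
  | mem g hg =>
    by_cases hgb : g = b
    · rw [hgb, (h b hb).1]; exact zero_le_one
    · rw [(h b hb).2 g (hG hg) hgb]
  | zero => simp
  | add x y _ _ hx hy => rw [map_add]; exact add_nonneg hx hy
  | smul a x _ hx =>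
    rw [show c b (a • x) = (a : ℝ) * c b x from map_smul (c b) (a : ℝ) x]
    exact mul_nonneg a.2 hx

theorem eq_zero (h : IsDualFamily B c) (hG : (G : Set V) ⊆ B)
    (hx : x ∈ PointedCone.hull ℝ (G : Set V)) {b : V} (hb : b ∈ B) (hbG : b ∉ G) :
    c b x = 0 := by
  induction hx using Submodule.span_induction with
  | mem g hg => exact (h b hb).2 g (hG hg) (fun e => hbG (e ▸ hg))
  | zero => simp
  | add x y _ _ hx hy => rw [map_add, hx, hy, add_zero]
  | smul a x _ hx =>
    rw [show c b (a • x) = (a : ℝ) * c b x from map_smul (c b) (a : ℝ) x, hx, mul_zero]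

theorem sum_eq (h : IsDualFamily B c) (hG : (G : Set V) ⊆ B)
    (hx : x ∈ PointedCone.hull ℝ (G : Set V)) : ∑ g ∈ G, c g x • g = x := by
  induction hx using Submodule.span_induction with
  | mem g hg =>
    rw [Finset.sum_eq_single_of_mem g hg fun b hb hbg => by
      rw [(h b (hG hb)).2 g (hG hg) (Ne.symm hbg), zero_smul], (h g (hG hg)).1, one_smul]
  | zero => simp
  | add x y _ _ hx hy =>
    simp only [map_add, add_smul, Finset.sum_add_distrib, hx, hy]
  | smul a x _ hx =>
    have : ∀ g, c g (a • x) = (a : ℝ) * c g x := fun g => map_smul (c g) (a : ℝ) x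
    simp only [this, mul_smul, ← Finset.smul_sum, hx]
    rfl

theorem mem_hull_of_eq_zero (h : IsDualFamily B c) (hG : (G : Set V) ⊆ B)
    (hx : x ∈ PointedCone.hull ℝ (G : Set V)) {s : Set V}
    (h0 : ∀ g ∈ G, g ∉ s → c g x = 0) : x ∈ PointedCone.hull ℝ s := by
  rw [← h.sum_eq hG hx]
  refine Submodule.sum_mem _ fun g hg => ?_
  by_cases hgs : g ∈ s
  · exact PointedCone.smul_mem _ (h.nonneg hG hx (hG hg)) (PointedCone.subset_hull hgs)
  · rw [h0 g hg hgs, zero_smul]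
    exact Submodule.zero_mem _

end IsDualFamily

/-- The dual coordinates of the generators outside `H` are nonnegative on the large cone and vanish
on the small one. -/
theorem isFaceOf_hull {B : Set V} (hB : LinearIndepOn ℝ id B) {G H : Finset V}
    (hG : (G : Set V) ⊆ B) (hH : H ⊆ G) :
    (PointedCone.hull ℝ (H : Set V)).IsFaceOf (PointedCone.hull ℝ (G : Set V)) := by
  obtain ⟨c, hc⟩ := exists_isDualFamily hB
  refine ⟨Submodule.span_mono (by exact_mod_cast hH), ?_⟩
  intro x y a hx hy ha hxy
  refine hc.mem_hull_of_eq_zero hG hx fun g hg hgH => ?_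
  have h0 := hc.eq_zero (fun z hz => hG (hH hz)) hxy (hG hg) hgH
  rw [map_add, map_smul, smul_eq_mul] at h0
  have h1 := hc.nonneg hG hx (hG hg)
  have h2 := hc.nonneg hG hy (hG hg)
  have h3 : a * c g x = 0 := le_antisymm (by linarith) (mul_nonneg ha.le h1)
  exact (mul_eq_zero.1 h3).resolve_left ha.ne'

theorem exists_sum_of_mem_hull {G : Finset V} {x : V}
    (hx : x ∈ PointedCone.hull ℝ (G : Set V)) :
    ∃ a : V → ℝ, (∀ g, 0 ≤ a g) ∧ ∑ g ∈ G, a g • g = x := by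
  obtain ⟨a, -, ha⟩ := Submodule.mem_span_finset.1 hx
  exact ⟨fun g => a g, fun g => (a g).2, ha⟩

/-- A face absorbs every summand that occurs with positive weight: single out the `i`-th term and
apply the face property to it and the remaining sum. -/
theorem mem_face_of_sum_mem {ι : Type*} {s : Finset ι} {f : ι → V} {a : ι → ℝ}
    {φ C : PointedCone ℝ V} (hφ : φ.IsFaceOf C) (hf : ∀ i ∈ s, f i ∈ C)
    (ha : ∀ i ∈ s, 0 ≤ a i) (hs : ∑ i ∈ s, a i • f i ∈ φ) {i : ι} (hi : i ∈ s) (hai : a i ≠ 0) :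
    f i ∈ φ := by
  classical
  rw [← Finset.add_sum_erase s _ hi] at hs
  refine hφ.mem_of_smul_add_mem (hf i hi) (Submodule.sum_mem _ fun j hj => ?_)
    (lt_of_le_of_ne (ha i hi) (Ne.symm hai)) hs
  exact PointedCone.smul_mem _ (ha j (Finset.mem_of_mem_erase hj))
    (hf j (Finset.mem_of_mem_erase hj))

theorem exists_eq_hull_of_isFaceOf {G : Finset V} {φ : PointedCone ℝ V}
    (hφ : φ.IsFaceOf (PointedCone.hull ℝ (G : Set V))) :
    ∃ H ⊆ G, φ = PointedCone.hull ℝ (H : Set V) := by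
  classical
  refine ⟨G.filter (· ∈ φ), Finset.filter_subset _ _, le_antisymm (fun x hx => ?_)
    (Submodule.span_le.2 fun g hg => (Finset.mem_filter.1 hg).2)⟩
  obtain ⟨a, ha, rfl⟩ := exists_sum_of_mem_hull (hφ.le hx)
  refine Submodule.sum_mem _ fun g hg => ?_
  by_cases hag : a g = 0
  · rw [hag, zero_smul]
    exact Submodule.zero_mem _
  · refine PointedCone.smul_mem _ (ha g) (PointedCone.subset_hull ?_)
    exact Finset.mem_filter.2 ⟨hg, mem_face_of_sum_mem hφ
      (fun g hg => PointedCone.subset_hull hg) (fun g _ => ha g) hx hg hag⟩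

theorem mem_of_mem_hull {B : Set V} (hB : LinearIndepOn ℝ id B) {H : Finset V}
    (hH : (H : Set V) ⊆ B) {g : V} (hg : g ∈ B) (h : g ∈ PointedCone.hull ℝ (H : Set V)) :
    g ∈ H := by
  obtain ⟨c, hc⟩ := exists_isDualFamily hB
  by_contra hgH
  have := hc.eq_zero hH h hg hgH
  rw [(hc g hg).1] at this
  exact one_ne_zero this

/-- `B` is a basis of the lattice `N`, linearly independent over the reals. -/
def IsLatticeBasis (N : Submodule ℤ V) (B : Set V) : Prop :=
  LinearIndepOn ℝ id B ∧ Submodule.span ℤ B = N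

variable {N : Submodule ℤ V}

theorem IsLatticeBasis.coord_int {B : Set V} (hB : IsLatticeBasis N B) {c : V → V →ₗ[ℝ] ℝ}
    (hc : IsDualFamily B c) {x : V} (hx : x ∈ N) {b : V} (hb : b ∈ B) :
    ∃ k : ℤ, c b x = k := by
  rw [← hB.2] at hx
  induction hx using Submodule.span_induction with
  | mem g hg =>
    by_cases hgb : g = b
    · exact ⟨1, by rw [hgb, (hc b hb).1]; simp⟩
    · exact ⟨0, by rw [(hc b hb).2 g hg hgb]; simp⟩
  | zero => exact ⟨0, by simp⟩
  | add x y _ _ hx hy =>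
    obtain ⟨k, hk⟩ := hx
    obtain ⟨l, hl⟩ := hy
    exact ⟨k + l, by rw [map_add, hk, hl]; push_cast; rfl⟩
  | smul a x _ hx =>
    obtain ⟨k, hk⟩ := hx
    exact ⟨a * k, by rw [map_zsmul, hk]; simp⟩

theorem IsLatticeBasis.ne_zero {B : Set V} (hB : IsLatticeBasis N B) {b : V} (hb : b ∈ B) :
    b ≠ 0 := by
  rintro rfl
  exact hB.1.zero_notMem_image ⟨0, hb, rfl⟩

theorem no_int_between {t : ℝ} (h0 : 0 < t) (h1 : t < 1) (k : ℤ) : t ≠ k := by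
  rintro rfl
  have h2 : (0 : ℤ) < k := by exact_mod_cast h0
  have h3 : k < (1 : ℤ) := by exact_mod_cast h1
  omega

theorem eq_of_primitive {u v : V} (hu : u ∈ N) (hv : v ∈ N) (hv0 : v ≠ 0)
    (hup : ∀ t : ℝ, 0 < t → t < 1 → t • u ∉ N) (hvp : ∀ t : ℝ, 0 < t → t < 1 → t • v ∉ N)
    (h : v ∈ PointedCone.hull ℝ {u}) : v = u := by
  obtain ⟨t, ht, rfl⟩ := mem_hull_singleton.1 h
  have ht0 : 0 < t := lt_of_le_of_ne ht (by rintro rfl; simp at hv0)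
  rcases lt_trichotomy t 1 with h1 | rfl | h1
  · exact absurd hv (hup t ht0 h1)
  · exact one_smul _ _
  · refine absurd ?_ (hvp t⁻¹ (inv_pos.2 ht0) (inv_lt_one_of_one_lt₀ h1))
    rwa [smul_smul, inv_mul_cancel₀ ht0.ne', one_smul]

/-- Dual coordinates are integral on `N`, so basis vectors are primitive. Conversely a ray, being a
face, is generated by elements of `G`, and primitivity identifies its lattice generator with one of
them. -/
theorem rayGens_hull {B : Set V} (hB : IsLatticeBasis N B) {G : Finset V}
    (hG : (G : Set V) ⊆ B) : rayGens N (PointedCone.hull ℝ (G : Set V)) = G := by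
  obtain ⟨c, hc⟩ := exists_isDualFamily hB.1
  have hBN : B ⊆ N := by rw [← hB.2]; exact Submodule.subset_span
  have hprim : ∀ b ∈ B, ∀ t : ℝ, 0 < t → t < 1 → t • b ∉ N := by
    intro b hb t h0 h1 hN
    obtain ⟨k, hk⟩ := hB.coord_int hc hN hb
    rw [map_smul, (hc b hb).1, smul_eq_mul, mul_one] at hk
    exact no_int_between h0 h1 k hk
  ext v
  constructor
  · rintro ⟨hvN, hv0, hvf, hvp⟩
    obtain ⟨H, hH, hHv⟩ := exists_eq_hull_of_isFaceOf hvf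
    have hne : H.Nonempty := by
      rw [Finset.nonempty_iff_ne_empty]
      rintro rfl
      have : v ∈ PointedCone.hull ℝ {v} := PointedCone.subset_hull rfl
      rw [hHv] at this
      simp at this
      exact hv0 this
    obtain ⟨g, hg⟩ := hne
    have hgv : g ∈ PointedCone.hull ℝ {v} := by
      rw [hHv]; exact PointedCone.subset_hull hg
    have hgB := hG (hH hg)
    have := eq_of_primitive hvN (hBN hgB) (hB.ne_zero hgB) hvp (hprim g hgB) hgv
    rw [← this]
    exact hH hg
  · intro hv
    have hvB := hG hv
    refine ⟨hBN hvB, hB.ne_zero hvB, ?_, hprim v hvB⟩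
    have := isFaceOf_hull hB.1 hG (H := {v}) (by simpa using hv)
    simpa using this

theorem salient_hull {B : Set V} (hB : LinearIndepOn ℝ id B) {G : Finset V}
    (hG : (G : Set V) ⊆ B) {x : V} (hx : x ∈ PointedCone.hull ℝ (G : Set V))
    (hx' : -x ∈ PointedCone.hull ℝ (G : Set V)) : x = 0 := by
  obtain ⟨c, hc⟩ := exists_isDualFamily hB
  rw [← hc.sum_eq hG hx]
  refine Finset.sum_eq_zero fun g hg => ?_
  have h1 := hc.nonneg hG hx (hG hg)
  have h2 := hc.nonneg hG hx' (hG hg)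
  rw [map_neg] at h2
  rw [le_antisymm (by linarith) h1, zero_smul]

/-- A unimodular change of basis; it is what keeps star subdivisions smooth. -/
theorem IsLatticeBasis.exchange {B : Set V} (hB : IsLatticeBasis N B) {u v : V} (hu : u ∈ B)
    (hv : v ∈ B) (huv : u ≠ v) : IsLatticeBasis N (insert (u + v) (B \ {u})) := by
  obtain ⟨c, hc⟩ := exists_isDualFamily hB.1
  constructor
  · rw [linearIndepOn_id_insert]
    · refine ⟨hB.1.mono Set.sdiff_subset, fun h => ?_⟩
      have h1 : Submodule.span ℝ (B \ {u}) ≤ LinearMap.ker (c u) :=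
        Submodule.span_le.2 fun b hb => (hc u hu).2 b hb.1 hb.2
      have h2 : c u (u + v) = 0 := h1 h
      rw [map_add, (hc u hu).1, (hc u hu).2 v hv (Ne.symm huv), add_zero] at h2
      exact one_ne_zero h2
    · rintro ⟨h, -⟩
      have h1 : c (u + v) (u + v) = 1 := (hc _ h).1
      have hv0 := hB.ne_zero hv
      have hu0 := hB.ne_zero hu
      rw [map_add, (hc _ h).2 u hu (by simpa using hv0),
        (hc _ h).2 v hv (by simpa using hu0)] at h1
      simp at h1
  · rw [← hB.2]
    refine le_antisymm (Submodule.span_le.2 ?_) (Submodule.span_le.2 fun b hb => ?_)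
    · rintro x (rfl | hx)
      · exact Submodule.add_mem _ (Submodule.subset_span hu) (Submodule.subset_span hv)
      · exact Submodule.subset_span hx.1
    · by_cases hbu : b = u
      · have h1 : u + v ∈ Submodule.span ℤ (insert (u + v) (B \ {u})) :=
          Submodule.subset_span (Set.mem_insert _ _)
        have h2 : v ∈ Submodule.span ℤ (insert (u + v) (B \ {u})) :=
          Submodule.subset_span (Set.mem_insert_of_mem _ ⟨hv, Ne.symm huv⟩)
        have := Submodule.sub_mem _ h1 h2
        rw [hbu]
        simpa using this
      · exact Submodule.subset_span (Set.mem_insert_of_mem _ ⟨hb, hbu⟩)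

end Cones

/-! ### Star subdivision along a two-dimensional cone -/

section Star

variable {V : Type*} [AddCommGroup V] [Module ℝ V]

/-- A fan each of whose cones is generated by part of a lattice basis. -/
structure IsRegularFan (N : Submodule ℤ V) (F : Set (PointedCone ℝ V)) : Prop
    extends IsFan N F where
  gens : ∀ σ ∈ F, ∃ (G : Finset V) (B : Set V), (G : Set V) ⊆ B ∧ IsLatticeBasis N B ∧
    σ = PointedCone.hull ℝ (G : Set V)

/-- `u` and `v` are the minimal ray generators of a two-dimensional cone of `F`. -/
structure IsStarPair (N : Submodule ℤ V) (F : Set (PointedCone ℝ V)) (u v : V) : Prop where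
  mem : PointedCone.hull ℝ {u, v} ∈ F
  ne : u ≠ v
  rayGens_eq : rayGens N (PointedCone.hull ℝ {u, v}) = {u, v}

/-- The cones of `F` that do not contain the cone over `u` and `v`, but lie in the closed star of
this cone. -/
def closedLink (F : Set (PointedCone ℝ V)) (u v : V) : Set (PointedCone ℝ V) :=
  {ρ ∈ F | ¬ PointedCone.hull ℝ {u, v} ≤ ρ ∧ ∃ σ ∈ F, PointedCone.hull ℝ {u, v} ≤ σ ∧ ρ ≤ σ}

variable {N : Submodule ℤ V} {F : Set (PointedCone ℝ V)} {u v : V}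

theorem isFaceOf_of_le (hF : IsFan N F) {ρ σ : PointedCone ℝ V} (hρ : ρ ∈ F) (hσ : σ ∈ F)
    (h : ρ ≤ σ) : ρ.IsFaceOf σ := by
  have := (hF.inter_face ρ hρ σ hσ).2
  rwa [inf_eq_left.2 h] at this

theorem IsRegularFan.isSmooth (hF : IsRegularFan N F) : IsSmooth N F := by
  intro σ hσ
  obtain ⟨G, B, hG, hB, rfl⟩ := hF.gens σ hσ
  refine ⟨B, by rwa [rayGens_hull hB hG], ?_, hB.2⟩
  exact LinearIndependent.restrict_scalars' ℤ hB.1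

theorem hull_insert (w : V) (s : Set V) :
    PointedCone.hull ℝ (insert w s) = PointedCone.hull ℝ s ⊔ PointedCone.hull ℝ {w} := by
  rw [PointedCone.hull, Submodule.span_insert, sup_comm]

theorem pair_le_iff {ρ : PointedCone ℝ V} :
    PointedCone.hull ℝ {u, v} ≤ ρ ↔ u ∈ ρ ∧ v ∈ ρ :=
  ⟨fun h => ⟨h (PointedCone.subset_hull (by simp)), h (PointedCone.subset_hull (by simp))⟩,
    fun h => hull_pair_le h.1 h.2⟩

theorem add_mem_pair_hull : u + v ∈ PointedCone.hull ℝ {u, v} :=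
  Submodule.add_mem _ (PointedCone.subset_hull (by simp)) (PointedCone.subset_hull (by simp))

/-- If `ρ₁` contained `y + t • (u + v)` with `t > 0`, the face `ρ₁ ⊓ σ` of `σ` would contain `u +
v`, hence `u` and `v`, contrary to `hτ`. -/
theorem inf_sup_eq_of_mem_closedLink (hF : IsRegularFan N F) {ρ₁ ρ₂ : PointedCone ℝ V} (h₁ : ρ₁ ∈ F)
    (hτ : ¬ PointedCone.hull ℝ {u, v} ≤ ρ₁) (h₂ : ρ₂ ∈ closedLink F u v) :
    ρ₁ ⊓ (ρ₂ ⊔ PointedCone.hull ℝ {u + v}) = ρ₁ ⊓ ρ₂ := by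
  refine le_antisymm (fun x hx => ?_) (inf_le_inf_left _ le_sup_left)
  obtain ⟨hx1, hx2⟩ := hx
  refine ⟨hx1, ?_⟩
  obtain ⟨y, hy, t, ht, rfl⟩ := mem_sup_hull_singleton.1 hx2
  obtain ⟨-, -, σ, hσ, hτσ, hρσ⟩ := h₂
  rcases ht.eq_or_lt with rfl | ht
  · simpa using hy
  · exfalso
    have hf := (hF.inter_face _ h₁ _ hσ).2
    have hw : u + v ∈ σ := hτσ add_mem_pair_hull
    have hyσ := hρσ hy
    have hmem : u + v ∈ ρ₁ ⊓ σ := by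
      refine hf.mem_of_smul_add_mem hw hyσ ht ⟨by rwa [add_comm], ?_⟩
      exact Submodule.add_mem _ (PointedCone.smul_mem _ ht.le hw) hyσ
    have huvσ := pair_le_iff.1 hτσ
    exact hτ (pair_le_iff.2 ⟨(hf.mem_of_add_mem_left huvσ.1 huvσ.2 hmem).1,
      (hf.mem_of_add_mem_right huvσ.1 huvσ.2 hmem).1⟩)

theorem mem_closedLink_of_le {ρ κ : PointedCone ℝ V} (hρ : ρ ∈ closedLink F u v) (hκ : κ ∈ F)
    (h : κ ≤ ρ) : κ ∈ closedLink F u v := by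
  obtain ⟨hρF, hτρ, σ, hσ, hτσ, hρσ⟩ := hρ
  exact ⟨hκ, fun h' => hτρ (h'.trans h), σ, hσ, hτσ, h.trans hρσ⟩

/-- Cancelling `s` copies of `u + v` puts `y₂` in the join of `ρ₁` with the new ray, and the
previous intersection formula applies. -/
theorem mem_inf_of_add_smul_eq (hF : IsRegularFan N F) {ρ₁ ρ₂ : PointedCone ℝ V} (h₁ : ρ₁ ∈ closedLink F u v)
    (h₂ : ρ₂ ∈ closedLink F u v) {y₁ y₂ : V} {s t : ℝ} (hy₁ : y₁ ∈ ρ₁) (hy₂ : y₂ ∈ ρ₂)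
    (hst : s ≤ t) (h : y₁ + t • (u + v) = y₂ + s • (u + v)) : y₂ ∈ ρ₁ ⊓ ρ₂ := by
  rw [inf_comm, ← inf_sup_eq_of_mem_closedLink hF h₂.1 h₂.2.1 h₁]
  refine ⟨hy₂, mem_sup_hull_singleton.2 ⟨y₁, hy₁, t - s, sub_nonneg.2 hst, ?_⟩⟩
  rw [sub_smul, ← add_sub_assoc, h, add_sub_cancel_right]

theorem sup_inf_sup_eq_of_mem_closedLink (hF : IsRegularFan N F) {ρ₁ ρ₂ : PointedCone ℝ V} (h₁ : ρ₁ ∈ closedLink F u v)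
    (h₂ : ρ₂ ∈ closedLink F u v) :
    (ρ₁ ⊔ PointedCone.hull ℝ {u + v}) ⊓ (ρ₂ ⊔ PointedCone.hull ℝ {u + v}) =
      (ρ₁ ⊓ ρ₂) ⊔ PointedCone.hull ℝ {u + v} := by
  refine le_antisymm (fun x hx => ?_)
    (le_inf (sup_le_sup_right inf_le_left _) (sup_le_sup_right inf_le_right _))
  obtain ⟨hx1, hx2⟩ := hx
  obtain ⟨y₁, hy₁, t, ht, rfl⟩ := mem_sup_hull_singleton.1 hx1
  obtain ⟨y₂, hy₂, s, hs, h⟩ := mem_sup_hull_singleton.1 hx2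
  rcases le_total s t with hst | hst
  · rw [h]
    exact mem_sup_hull_singleton.2
      ⟨y₂, mem_inf_of_add_smul_eq hF h₁ h₂ hy₁ hy₂ hst h, s, hs, rfl⟩
  · refine mem_sup_hull_singleton.2 ⟨y₁, ?_, t, ht, rfl⟩
    rw [inf_comm]
    exact mem_inf_of_add_smul_eq hF h₂ h₁ hy₂ hy₁ hst h.symm

namespace IsStarPair

variable (huv : IsStarPair N F u v) (hF : IsRegularFan N F)
include huv

theorem starCenter_eq : starCenter N (PointedCone.hull ℝ {u, v}) = u + v := by
  rw [starCenter, huv.rayGens_eq, finsum_mem_pair huv.ne]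

theorem two_le_ncard : 2 ≤ (rayGens N (PointedCone.hull ℝ {u, v})).ncard := by
  rw [huv.rayGens_eq, Set.ncard_pair huv.ne]

theorem ne_zero_left : u ≠ 0 := by
  have : u ∈ rayGens N (PointedCone.hull ℝ {u, v}) := by rw [huv.rayGens_eq]; simp
  exact this.2.1

theorem ne_zero_right : v ≠ 0 := by
  have : v ∈ rayGens N (PointedCone.hull ℝ {u, v}) := by rw [huv.rayGens_eq]; simp
  exact this.2.1

include hF

theorem subset_rayGens {σ : PointedCone ℝ V} (hσ : σ ∈ F) (h : PointedCone.hull ℝ {u, v} ≤ σ) :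
    {u, v} ⊆ rayGens N σ := by
  intro x hx
  rw [← huv.rayGens_eq] at hx
  exact ⟨hx.1, hx.2.1, hx.2.2.1.trans (isFaceOf_of_le hF.toIsFan huv.mem hσ h), hx.2.2.2⟩

theorem mem_gens {B : Set V} (hB : IsLatticeBasis N B) {G : Finset V}
    (hG : (G : Set V) ⊆ B) (hσ : PointedCone.hull ℝ (G : Set V) ∈ F)
    (h : PointedCone.hull ℝ {u, v} ≤ PointedCone.hull ℝ (G : Set V)) : u ∈ G ∧ v ∈ G := by
  have := huv.subset_rayGens hF hσ h
  rw [rayGens_hull hB hG] at this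
  exact ⟨this (by simp), this (by simp)⟩

/-- The generators of `ρ` omit `u` or `v`; the omitted one is exchanged for `u + v`. -/
theorem exists_basis_of_closedLink {ρ : PointedCone ℝ V} (hρ : ρ ∈ closedLink F u v) :
    ∃ (H : Finset V) (B : Set V), (H : Set V) ⊆ B ∧ u + v ∈ B ∧ IsLatticeBasis N B ∧
      ρ = PointedCone.hull ℝ (H : Set V) := by
  obtain ⟨hρF, hτρ, σ, hσ, hτσ, hρσ⟩ := hρ
  obtain ⟨G, B, hG, hB, rfl⟩ := hF.gens σ hσ
  obtain ⟨H, hH, rfl⟩ := exists_eq_hull_of_isFaceOf (isFaceOf_of_le hF.toIsFan hρF hσ hρσ)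
  obtain ⟨hu, hv⟩ := huv.mem_gens hF hB hG hσ hτσ
  have hnot : u ∉ H ∨ v ∉ H := by
    by_contra! h
    exact hτρ (pair_le_iff.2 ⟨PointedCone.subset_hull h.1, PointedCone.subset_hull h.2⟩)
  rcases hnot with h | h
  · refine ⟨H, _, ?_, Set.mem_insert _ _, hB.exchange (hG hu) (hG hv) huv.ne, rfl⟩
    exact fun x hx => Set.mem_insert_of_mem _ ⟨hG (hH hx), fun e => h (e ▸ hx)⟩
  · refine ⟨H, insert (v + u) (B \ {v}), ?_, ?_, hB.exchange (hG hv) (hG hu) huv.ne.symm, rfl⟩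
    · exact fun x hx => Set.mem_insert_of_mem _ ⟨hG (hH hx), fun e => h (e ▸ hx)⟩
    · rw [add_comm]; exact Set.mem_insert _ _

/-- With `H = A ∩ G`, a generating set `A` is `H` or `H ∪ {u + v}`, so each new cone is a cone of
`F` or the join of one with the new ray. Later arguments use only this description. -/
theorem starSubdivision_eq : starSubdivision N F (PointedCone.hull ℝ {u, v}) =
    {ρ ∈ F | ¬ PointedCone.hull ℝ {u, v} ≤ ρ} ∪
      (fun ρ => ρ ⊔ PointedCone.hull ℝ {u + v}) '' closedLink F u v := by
  rw [starSubdivision]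
  simp only [coneStarSubdivision, huv.starCenter_eq, huv.rayGens_eq]
  apply Set.Subset.antisymm
  · refine Set.union_subset Set.subset_union_left ?_
    intro x hx
    simp only [Set.mem_iUnion] at hx
    obtain ⟨σ, ⟨hσ, hτσ⟩, A, hA, hA', rfl⟩ := hx
    obtain ⟨G, B, hG, hB, rfl⟩ := hF.gens σ hσ
    rw [rayGens_hull hB hG] at hA
    classical
    set H : Finset V := G.filter (· ∈ A) with hH
    have hHG : H ⊆ G := Finset.filter_subset _ _
    have hf := isFaceOf_hull hB.1 hG hHG
    have hHF := hF.face_mem _ hσ _ hf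
    have hτH : ¬ PointedCone.hull ℝ {u, v} ≤ PointedCone.hull ℝ (H : Set V) := by
      intro h
      obtain ⟨h1, h2⟩ := huv.mem_gens hF hB (fun x hx => hG (hHG hx)) hHF h
      refine hA' ?_
      rintro x (rfl | rfl)
      · exact (Finset.mem_filter.1 h1).2
      · exact (Finset.mem_filter.1 h2).2
    by_cases hw : u + v ∈ A
    · right
      refine ⟨_, ⟨hHF, hτH, _, hσ, hτσ, hf.le⟩, ?_⟩
      simp only
      rw [← hull_insert]
      congr 1
      ext x
      simp only [Set.mem_insert_iff, Finset.mem_coe, hH, Finset.mem_filter]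
      constructor
      · rintro (rfl | h)
        exacts [hw, h.2]
      · intro hx
        rcases hA hx with h | h
        exacts [Or.inr ⟨h, hx⟩, Or.inl h]
    · left
      have hAH : A = (H : Set V) := by
        ext x
        simp only [Finset.mem_coe, hH, Finset.mem_filter]
        refine ⟨fun hx => ⟨?_, hx⟩, fun hx => hx.2⟩
        rcases hA hx with h | h
        exacts [h, absurd (h ▸ hx) hw]
      rw [hAH]
      exact ⟨hHF, hτH⟩
  · refine Set.union_subset Set.subset_union_left ?_
    rintro _ ⟨ρ, ⟨hρ, hτρ, σ, hσ, hτσ, hρσ⟩, rfl⟩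
    right
    simp only [Set.mem_iUnion]
    obtain ⟨G, B, hG, hB, rfl⟩ := hF.gens σ hσ
    obtain ⟨H, hH, rfl⟩ := exists_eq_hull_of_isFaceOf (isFaceOf_of_le hF.toIsFan hρ hσ hρσ)
    refine ⟨_, ⟨hσ, hτσ⟩, insert (u + v) (H : Set V), ?_, ?_, (hull_insert _ _).symm⟩
    · rw [rayGens_hull hB hG]
      rintro x (rfl | hx)
      exacts [Or.inr rfl, Or.inl (hH hx)]
    · intro h
      have h1 : u ∈ insert (u + v) (H : Set V) := h (by simp)
      have h2 : v ∈ insert (u + v) (H : Set V) := h (by simp)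
      rcases h1 with h1 | h1
      · exact huv.ne_zero_right (by simpa using h1)
      rcases h2 with h2 | h2
      · exact huv.ne_zero_left (by simpa using h2)
      exact hτρ (pair_le_iff.2 ⟨PointedCone.subset_hull h1, PointedCone.subset_hull h2⟩)

theorem isFaceOf_sup {ρ κ : PointedCone ℝ V} (hρ : ρ ∈ closedLink F u v)
    (hκ : κ.IsFaceOf ρ) :
    (κ ⊔ PointedCone.hull ℝ {u + v}).IsFaceOf (ρ ⊔ PointedCone.hull ℝ {u + v}) ∧
    κ.IsFaceOf (ρ ⊔ PointedCone.hull ℝ {u + v}) := by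
  classical
  obtain ⟨H, B, hH, hw, hB, rfl⟩ := huv.exists_basis_of_closedLink hF hρ
  obtain ⟨K, hK, rfl⟩ := exists_eq_hull_of_isFaceOf hκ
  have hG : ((insert (u + v) H : Finset V) : Set V) ⊆ B := by
    rw [Finset.coe_insert]; exact Set.insert_subset hw hH
  rw [← hull_insert, ← hull_insert, ← Finset.coe_insert, ← Finset.coe_insert]
  exact ⟨isFaceOf_hull hB.1 hG (Finset.insert_subset_insert _ hK),
    isFaceOf_hull hB.1 hG (hK.trans (Finset.subset_insert _ _))⟩

theorem isRegularFan_starSubdivision :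
    IsRegularFan N (starSubdivision N F (PointedCone.hull ℝ {u, v})) := by
  classical
  have hgens : ∀ σ ∈ starSubdivision N F (PointedCone.hull ℝ {u, v}),
      ∃ (G : Finset V) (B : Set V), (G : Set V) ⊆ B ∧ IsLatticeBasis N B ∧
        σ = PointedCone.hull ℝ (G : Set V) := by
    rw [huv.starSubdivision_eq hF]
    rintro σ (hσ | ⟨ρ, hρ, rfl⟩)
    · exact hF.gens σ hσ.1
    · obtain ⟨H, B, hH, hw, hB, rfl⟩ := huv.exists_basis_of_closedLink hF hρ
      refine ⟨insert (u + v) H, B, ?_, hB, ?_⟩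
      · rw [Finset.coe_insert]; exact Set.insert_subset hw hH
      · simp only
        rw [← hull_insert, Finset.coe_insert]
  refine ⟨⟨?_, ?_, ?_, ?_⟩, hgens⟩
  · rw [huv.starSubdivision_eq hF]
    exact (hF.finite.subset (Set.sep_subset _ _)).union
      ((hF.finite.subset (Set.sep_subset _ _)).image _)
  · intro σ hσ
    obtain ⟨G, B, hG, hB, rfl⟩ := hgens σ hσ
    refine ⟨⟨G, ?_, rfl⟩, fun x hx hx' => salient_hull hB.1 hG hx hx'⟩
    rw [← hB.2]
    exact hG.trans Submodule.subset_span
  · rw [huv.starSubdivision_eq hF]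
    rintro σ (hσ | ⟨ρ, hρ, rfl⟩) κ hκ
    · exact Or.inl ⟨hF.face_mem _ hσ.1 _ hκ, fun h => hσ.2 (h.trans hκ.le)⟩
    · obtain ⟨H, B, hH, hw, hB, rfl⟩ := huv.exists_basis_of_closedLink hF hρ
      simp only at hκ
      rw [← hull_insert, ← Finset.coe_insert] at hκ
      obtain ⟨K, hK, rfl⟩ := exists_eq_hull_of_isFaceOf hκ
      have hK' : K.erase (u + v) ⊆ H := Finset.subset_insert_iff.1 hK
      have hf := isFaceOf_hull hB.1 hH hK'
      have hl := mem_closedLink_of_le hρ (hF.face_mem _ hρ.1 _ hf) hf.le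
      by_cases hwK : u + v ∈ K
      · right
        refine ⟨_, hl, ?_⟩
        simp only
        rw [← hull_insert, ← Finset.coe_insert, Finset.insert_erase hwK]
      · left
        rw [Finset.erase_eq_of_notMem hwK] at hl
        exact ⟨hl.1, hl.2.1⟩
  · rw [huv.starSubdivision_eq hF]
    have key : ∀ σ ∈ F, ¬ PointedCone.hull ℝ {u, v} ≤ σ → ∀ ρ ∈ closedLink F u v,
        (σ ⊓ (ρ ⊔ PointedCone.hull ℝ {u + v})).IsFaceOf σ ∧
        (σ ⊓ (ρ ⊔ PointedCone.hull ℝ {u + v})).IsFaceOf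
          (ρ ⊔ PointedCone.hull ℝ {u + v}) := by
      intro σ hσ hτ ρ hρ
      rw [inf_sup_eq_of_mem_closedLink hF hσ hτ hρ]
      have := hF.inter_face _ hσ _ hρ.1
      exact ⟨this.1, (huv.isFaceOf_sup hF hρ this.2).2⟩
    rintro σ (hσ | ⟨ρ, hρ, rfl⟩) σ' (hσ' | ⟨ρ', hρ', rfl⟩)
    · exact hF.inter_face _ hσ.1 _ hσ'.1
    · exact key _ hσ.1 hσ.2 _ hρ'
    · rw [inf_comm]
      exact (key _ hσ'.1 hσ'.2 _ hρ).symm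
    · simp only
      rw [sup_inf_sup_eq_of_mem_closedLink hF hρ hρ']
      have := hF.inter_face _ hρ.1 _ hρ'.1
      exact ⟨(huv.isFaceOf_sup hF hρ this.1).1, (huv.isFaceOf_sup hF hρ' this.2).1⟩

theorem isSmoothStarSubdivision :
    IsSmoothStarSubdivision N F (starSubdivision N F (PointedCone.hull ℝ {u, v})) :=
  ⟨hF.toIsFan, hF.isSmooth, _, huv.mem, huv.two_le_ncard, rfl⟩

omit hF in
theorem symm : IsStarPair N F v u := by
  refine ⟨?_, huv.ne.symm, ?_⟩
  · rw [Set.pair_comm]; exact huv.mem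
  · rw [Set.pair_comm]; exact huv.rayGens_eq

/-- The half of the cone over `G` on which the coordinate of `u` is at most that of `v` lies in a
cone of the star subdivision. -/
theorem exists_mem_half {B : Set V} (hB : IsLatticeBasis N B) {c : V → V →ₗ[ℝ] ℝ}
    (hc : IsDualFamily B c) {G : Finset V} (hG : (G : Set V) ⊆ B)
    (hσ : PointedCone.hull ℝ (G : Set V) ∈ F)
    (h : PointedCone.hull ℝ {u, v} ≤ PointedCone.hull ℝ (G : Set V)) :
    ∃ κ ∈ starSubdivision N F (PointedCone.hull ℝ {u, v}),
      ∀ x ∈ PointedCone.hull ℝ (G : Set V), c u x ≤ c v x → x ∈ κ := by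
  classical
  obtain ⟨hu, hv⟩ := huv.mem_gens hF hB hG hσ h
  rw [huv.starSubdivision_eq hF]
  have hf := isFaceOf_hull hB.1 hG (G.erase_subset u)
  have hlink : PointedCone.hull ℝ (G.erase u : Set V) ∈ closedLink F u v := by
    refine ⟨hF.face_mem _ hσ _ (by exact_mod_cast hf), fun h' => ?_, _, hσ, h, by exact_mod_cast hf.le⟩
    have := mem_of_mem_hull hB.1 (fun x hx => hG (Finset.mem_of_mem_erase hx)) (hG hu)
      ((pair_le_iff.1 h').1)
    exact Finset.notMem_erase u G this
  refine ⟨_, Or.inr ⟨_, hlink, rfl⟩, fun x hx hxuv => ?_⟩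
  -- Removing `c u x` copies of `u + v` kills the `u`-coordinate and leaves `c v x - c u x ≥ 0` at
  -- `v`.
  refine mem_sup_hull_singleton.2 ⟨x - c u x • (u + v), ?_, c u x,
    hc.nonneg hG hx (hG hu), (sub_add_cancel _ _).symm⟩
  have hvu : v ∈ G.erase u := Finset.mem_erase.2 ⟨huv.ne.symm, hv⟩
  have hx' : x - c u x • (u + v) =
      (c v x - c u x) • v + ∑ g ∈ (G.erase u).erase v, c g x • g := by
    nth_rewrite 1 [← hc.sum_eq hG hx]
    rw [← Finset.add_sum_erase G _ hu, ← Finset.add_sum_erase _ _ hvu]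
    module
  rw [hx']
  refine Submodule.add_mem _ (PointedCone.smul_mem _ (sub_nonneg.2 hxuv)
    (PointedCone.subset_hull (Finset.mem_coe.2 hvu))) (sum_mem_hull ?_ fun g hg => ?_)
  · exact fun g hg => Finset.mem_of_mem_erase hg
  · exact hc.nonneg hG hx (hG (Finset.mem_of_mem_erase (Finset.mem_of_mem_erase hg)))

omit hF in
theorem not_le_hull_singleton (w : V) :
    ¬ PointedCone.hull ℝ {u, v} ≤ PointedCone.hull ℝ {w} := by
  intro h
  obtain ⟨hu, hv⟩ := pair_le_iff.1 h
  obtain ⟨a, ha, hau⟩ := mem_hull_singleton.1 hu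
  obtain ⟨b, hb, hbv⟩ := mem_hull_singleton.1 hv
  have hur : u ∈ rayGens N (PointedCone.hull ℝ {u, v}) := by rw [huv.rayGens_eq]; simp
  have hvr : v ∈ rayGens N (PointedCone.hull ℝ {u, v}) := by rw [huv.rayGens_eq]; simp
  have ha0 : a ≠ 0 := by
    rintro rfl
    exact hur.2.1 (by rw [hau, zero_smul])
  refine huv.ne (eq_of_primitive hur.1 hvr.1 hvr.2.1 hur.2.2.2 hvr.2.2.2
    (mem_hull_singleton.2 ⟨b * a⁻¹, mul_nonneg hb (inv_nonneg.2 ha), ?_⟩)).symm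
  rw [hau, smul_smul, mul_assoc, inv_mul_cancel₀ ha0, mul_one, ← hbv]

theorem add_ne_zero : u + v ≠ 0 := by
  intro h
  refine huv.ne_zero_left ((hF.rational _ huv.mem).2 u (PointedCone.subset_hull (by simp)) ?_)
  rw [neg_eq_of_add_eq_zero_right h]
  exact PointedCone.subset_hull (by simp)

/-- Such a ray would be a face of the cone over `u` and `v`; containing `u + v`, it would contain
both `u` and `v`. -/
theorem hull_add_notMem : PointedCone.hull ℝ {u + v} ∉ F := by
  intro h
  have hf := isFaceOf_of_le hF.toIsFan h huv.mem
    (Submodule.span_le.2 (by simpa using add_mem_pair_hull))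
  obtain ⟨hu, hv⟩ := pair_le_iff.1 (le_refl (PointedCone.hull ℝ {u, v}))
  have hw : u + v ∈ PointedCone.hull ℝ {u + v} := PointedCone.subset_hull rfl
  exact huv.not_le_hull_singleton (u + v)
    (pair_le_iff.2 ⟨hf.mem_of_add_mem_left hu hv hw, hf.mem_of_add_mem_right hu hv hw⟩)

theorem hull_add_mem_starSubdivision :
    PointedCone.hull ℝ {u + v} ∈ starSubdivision N F (PointedCone.hull ℝ {u, v}) := by
  rw [huv.starSubdivision_eq hF]
  obtain ⟨G, B, hG, hB, h⟩ := hF.gens _ huv.mem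
  have hbot := hF.face_mem _ huv.mem _ (h ▸ isFaceOf_hull hB.1 hG G.empty_subset)
  rw [Finset.coe_empty, PointedCone.hull, Submodule.span_empty] at hbot
  refine Or.inr ⟨⊥, ⟨hbot, fun h => huv.ne_zero_left ?_, _, huv.mem, le_rfl, bot_le⟩, bot_sup_eq _⟩
  exact (Submodule.mem_bot _).1 (pair_le_iff.1 h).1

end IsStarPair

end Star

/-! ### Extremal generators of strongly convex cones -/

section Extremal

variable {V : Type*} [AddCommGroup V] [Module ℝ V]

theorem exists_minimal_generators (s : Finset V) :
    ∃ t ⊆ s, PointedCone.hull ℝ (t : Set V) = PointedCone.hull ℝ (s : Set V) ∧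
      ∀ v ∈ t, v ∉ PointedCone.hull ℝ ((t : Set V) \ {v}) := by
  classical
  obtain ⟨t, ht, hmin⟩ := Finset.exists_min_image
    (s.powerset.filter fun t : Finset V => PointedCone.hull ℝ (t : Set V) = PointedCone.hull ℝ (s : Set V))
    Finset.card ⟨s, by simp⟩
  rw [Finset.mem_filter, Finset.mem_powerset] at ht
  refine ⟨t, ht.1, ht.2, fun v hv hmem => ?_⟩
  have h : PointedCone.hull ℝ ((t.erase v : Finset V) : Set V) =
      PointedCone.hull ℝ (s : Set V) := by
    rw [← ht.2, Finset.coe_erase]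
    refine le_antisymm (Submodule.span_mono Set.sdiff_subset)
      (Submodule.span_le.2 fun x hx => ?_)
    by_cases hxv : x = v
    · rw [hxv]; exact hmem
    · exact PointedCone.subset_hull ⟨hx, hxv⟩
  have := hmin (t.erase v) (Finset.mem_filter.2
    ⟨Finset.mem_powerset.2 ((Finset.erase_subset _ _).trans ht.1), h⟩)
  exact absurd this (not_le.2 (Finset.card_erase_lt_of_mem hv))

/-- Write a point of the ray as `a • x + y` and compare the coefficient `d v` of `v` with the
multiple `r`. If `d v < r`, then `v` is redundant; otherwise the other terms sum to a nonpositive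
multiple of `v`, and strong convexity makes them vanish. -/
theorem isFaceOf_hull_singleton {t : Finset V} {v : V} (hv : v ∈ t)
    (hmin : v ∉ PointedCone.hull ℝ ((t : Set V) \ {v}))
    (hs : ∀ x ∈ PointedCone.hull ℝ (t : Set V), -x ∈ PointedCone.hull ℝ (t : Set V) → x = 0) :
    (PointedCone.hull ℝ {v}).IsFaceOf (PointedCone.hull ℝ (t : Set V)) := by
  classical
  refine ⟨Submodule.span_mono (by simpa using hv), fun {x y a} hx hy ha hxy => ?_⟩
  obtain ⟨p, hp, rfl⟩ := exists_sum_of_mem_hull hx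
  obtain ⟨q, hq, rfl⟩ := exists_sum_of_mem_hull hy
  obtain ⟨r, hr, h⟩ := mem_hull_singleton.1 hxy
  set d : V → ℝ := fun g => a * p g + q g with hd
  have hd0 : ∀ g, 0 ≤ d g := fun g => add_nonneg (mul_nonneg ha.le (hp g)) (hq g)
  have h1 : d v • v + ∑ g ∈ t.erase v, d g • g = r • v := by
    rw [Finset.add_sum_erase t (fun g => d g • g) hv, ← h, Finset.smul_sum,
      ← Finset.sum_add_distrib]
    exact Finset.sum_congr rfl fun g _ => by rw [hd]; module
  have hsub : ((t.erase v : Finset V) : Set V) ⊆ (t : Set V) \ {v} := by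
    rw [Finset.coe_erase]
  have h2 : ∑ g ∈ t.erase v, d g • g = (r - d v) • v := by
    rw [sub_smul, ← h1]; abel
  rcases lt_or_ge (d v) r with hlt | hge
  · exfalso
    refine hmin ?_
    have h3 : v = (r - d v)⁻¹ • ∑ g ∈ t.erase v, d g • g := by
      rw [h2, smul_smul, inv_mul_cancel₀ (sub_pos.2 hlt).ne', one_smul]
    have h4 : (r - d v)⁻¹ • ∑ g ∈ t.erase v, d g • g ∈
        PointedCone.hull ℝ ((t : Set V) \ {v}) :=
      PointedCone.smul_mem _ (inv_nonneg.2 (sub_pos.2 hlt).le)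
        (sum_mem_hull hsub fun g _ => hd0 g)
    rwa [← h3] at h4
  · have hmemv : v ∈ PointedCone.hull ℝ (t : Set V) := PointedCone.subset_hull hv
    have hz : ∑ g ∈ t.erase v, d g • g = 0 := by
      refine hs _ (sum_mem_hull (by simp) fun g _ => hd0 g) ?_
      rw [h2, ← neg_smul, neg_sub]
      exact PointedCone.smul_mem _ (sub_nonneg.2 hge) hmemv
    -- The lineality space is a face, so it contains each summand of a vanishing positive
    -- combination; here it is zero.
    have hterm : ∀ g ∈ t.erase v, d g = 0 ∨ g = 0 := by
      intro g hg
      by_contra! hne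
      have hmem := mem_face_of_sum_mem (PointedCone.IsFaceOf.lineal
        (PointedCone.hull ℝ (t : Set V))) (s := t.erase v) (f := id) (a := d)
        (fun i hi => PointedCone.subset_hull (Finset.mem_of_mem_erase hi)) (fun g _ => hd0 g)
        (by simp only [id]; rw [hz]; exact Submodule.zero_mem _) hg hne.1
      have hmem' := PointedCone.mem_lineal.1 hmem
      exact hne.2 (hs _ hmem'.1 hmem'.2)
    refine mem_hull_singleton.2 ⟨p v, hp v, ?_⟩
    rw [← Finset.add_sum_erase t _ hv, add_eq_left]
    refine Finset.sum_eq_zero fun g hg => ?_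
    rcases hterm g hg with h0 | h0
    · have h5 := mul_nonneg ha.le (hp g)
      have h6 := hq g
      have h7 : a * p g = 0 := by simp only [hd] at h0; linarith
      rw [(mul_eq_zero.1 h7).resolve_left ha.ne', zero_smul]
    · rw [h0, smul_zero]

theorem IsRationalCone.exists_extremal {N : Submodule ℤ V} {σ : PointedCone ℝ V}
    (h : IsRationalCone N σ) : ∃ t : Finset V, (t : Set V) ⊆ N ∧
      σ = PointedCone.hull ℝ (t : Set V) ∧
      ∀ v ∈ t, v ≠ 0 ∧ (PointedCone.hull ℝ {v}).IsFaceOf σ := by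
  obtain ⟨⟨s, hsN, rfl⟩, hs⟩ := h
  obtain ⟨t, hts, ht, hmin⟩ := exists_minimal_generators s
  refine ⟨t, fun x hx => hsN (hts hx), ht.symm, fun v hv => ⟨?_, ?_⟩⟩
  · rintro rfl
    exact hmin 0 hv (Submodule.zero_mem _)
  · rw [← ht] at hs ⊢
    exact isFaceOf_hull_singleton hv (hmin v hv) hs

end Extremal

/-! ### Indicator classes and Weyl chambers -/

section Braid

variable {n : ℕ}

/-- The quotient map `ℝⁿ → N_ℝ`. -/
noncomputable def toBraid (n : ℕ) : (Fin n → ℝ) →ₗ[ℝ] BraidSpace n :=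
  (Submodule.span ℝ {(1 : Fin n → ℝ)}).mkQ

theorem toBraid_surjective : Function.Surjective (toBraid n) :=
  Submodule.mkQ_surjective _

@[simp]
theorem coordDiff_toBraid (i j : Fin n) (f : Fin n → ℝ) :
    coordDiff i j (toBraid n f) = f j - f i := rfl

theorem braid_ext {x y : BraidSpace n} (h : ∀ i j, coordDiff i j x = coordDiff i j y) :
    x = y := by
  obtain ⟨f, rfl⟩ := toBraid_surjective x
  obtain ⟨g, rfl⟩ := toBraid_surjective y
  simp only [coordDiff_toBraid] at h
  rw [toBraid, Submodule.mkQ_apply, Submodule.mkQ_apply, Submodule.Quotient.eq,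
    Submodule.mem_span_singleton]
  rcases isEmpty_or_nonempty (Fin n) with hn | ⟨⟨i₀⟩⟩
  · exact ⟨0, funext fun i => hn.elim i⟩
  · refine ⟨f i₀ - g i₀, funext fun i => ?_⟩
    have := h i₀ i
    simp only [Pi.smul_apply, Pi.one_apply, smul_eq_mul, mul_one, Pi.sub_apply]
    linarith

theorem mem_weylChamber_toBraid {π : Equiv.Perm (Fin n)} {f : Fin n → ℝ} :
    toBraid n f ∈ weylChamber π ↔ Monotone (f ∘ π) :=
  ⟨fun h i j hij => sub_nonneg.1 (h i j hij), fun h _ _ hij => sub_nonneg.2 (h hij)⟩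

/-- The class of the indicator vector of `S`. -/
noncomputable def indicatorClass (S : Finset (Fin n)) : BraidSpace n :=
  toBraid n fun i => if i ∈ S then 1 else 0

theorem coordDiff_indicatorClass (S : Finset (Fin n)) (i j : Fin n) :
    coordDiff i j (indicatorClass S) = (if j ∈ S then 1 else 0) - if i ∈ S then 1 else 0 := rfl

theorem indicatorClass_mem_lattice (S : Finset (Fin n)) : indicatorClass S ∈ braidLattice n := by
  refine ⟨fun i => if i ∈ S then 1 else 0, ?_⟩
  refine braid_ext fun i j => ?_
  rw [coordDiff_indicatorClass]
  change (((if j ∈ S then 1 else 0 : ℤ) : ℝ) - ((if i ∈ S then 1 else 0 : ℤ) : ℝ)) = _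
  push_cast
  rfl

theorem coordDiff_int {x : BraidSpace n} (hx : x ∈ braidLattice n) (i j : Fin n) :
    ∃ k : ℤ, coordDiff i j x = k := by
  obtain ⟨z, rfl⟩ := hx
  refine ⟨z j - z i, ?_⟩
  change ((z j : ℝ) - (z i : ℝ)) = _
  push_cast
  rfl

theorem exists_sep_of_ne_zero {S : Finset (Fin n)} (h : indicatorClass S ≠ 0) :
    ∃ i j, i ∉ S ∧ j ∈ S := by
  by_contra! hS
  refine h (braid_ext fun i j => ?_)
  rw [coordDiff_indicatorClass, map_zero]
  by_cases hi : i ∈ S <;> by_cases hj : j ∈ S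
  · simp [hi, hj]
  · exact absurd hi (hS j i hj)
  · exact absurd hj (hS i j hi)
  · simp [hi, hj]

theorem indicatorClass_primitive {S : Finset (Fin n)} (h : indicatorClass S ≠ 0) {t : ℝ}
    (h0 : 0 < t) (h1 : t < 1) : t • indicatorClass S ∉ braidLattice n := by
  intro hN
  obtain ⟨i, j, hi, hj⟩ := exists_sep_of_ne_zero h
  obtain ⟨k, hk⟩ := coordDiff_int hN i j
  rw [map_smul, coordDiff_indicatorClass] at hk
  simp only [hi, hj, if_true, if_false, sub_zero, smul_eq_mul, mul_one] at hk
  exact no_int_between h0 h1 k hk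

/-- Coordinates are compared with that of a point `i ∉ S`. Nonvanishing is needed, as the empty and
the full set both have class zero. -/
theorem indicatorClass_subset {S T : Finset (Fin n)} (h : indicatorClass S ≠ 0)
    (hST : indicatorClass S = indicatorClass T) : S ⊆ T := by
  obtain ⟨i, -, hi, -⟩ := exists_sep_of_ne_zero h
  intro j hj
  have h1 := coordDiff_indicatorClass S i j
  rw [hST, coordDiff_indicatorClass] at h1
  simp only [hi, hj, if_true, if_false, sub_zero] at h1
  by_contra hjT
  simp only [hjT, if_false] at h1
  split_ifs at h1 <;> norm_num at h1

theorem indicatorClass_injective {S T : Finset (Fin n)} (h : indicatorClass S ≠ 0)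
    (hST : indicatorClass S = indicatorClass T) : S = T :=
  (indicatorClass_subset h hST).antisymm (indicatorClass_subset (hST ▸ h) hST.symm)

theorem indicatorClass_add (S T : Finset (Fin n)) :
    indicatorClass S + indicatorClass T = indicatorClass (S ∩ T) + indicatorClass (S ∪ T) := by
  rw [indicatorClass, indicatorClass, indicatorClass, indicatorClass, ← map_add, ← map_add]
  congr 1
  funext i
  by_cases h1 : i ∈ S <;> by_cases h2 : i ∈ T <;> simp [h1, h2]

/-- The upper sets of the chamber of `π`. -/
def chamberSet (π : Equiv.Perm (Fin n)) (k : ℕ) : Finset (Fin n) :=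
  Finset.univ.filter fun i => k < (π.symm i : ℕ)

theorem indicatorClass_chamberSet_mem (π : Equiv.Perm (Fin n)) (k : ℕ) :
    indicatorClass (chamberSet π k) ∈ weylChamber π := by
  rw [indicatorClass, mem_weylChamber_toBraid]
  intro i j hij
  simp only [Function.comp, chamberSet, Finset.mem_filter, Finset.mem_univ, true_and,
    Equiv.symm_apply_apply]
  have : (i : ℕ) ≤ j := hij
  split_ifs <;> first | omega | norm_num

/-- Summation by parts: the coefficients are the gaps between consecutive sorted coordinates. -/
theorem exists_sum_of_mem_weylChamber {π : Equiv.Perm (Fin n)} {x : BraidSpace n}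
    (hx : x ∈ weylChamber π) : ∃ a : ℕ → ℝ, (∀ k, 0 ≤ a k) ∧
      ∑ k ∈ Finset.range n, a k • indicatorClass (chamberSet π k) = x := by
  obtain ⟨f, rfl⟩ := toBraid_surjective x
  rw [mem_weylChamber_toBraid] at hx
  rcases n with _ | m
  · exact ⟨0, fun _ => le_rfl, braid_ext fun i => i.elim0⟩
  -- Capping the index at `m` makes the last gap zero, so the sum may run over all `m + 1` indices.
  set h : ℕ → ℝ := fun k => f (π ⟨min k m, by omega⟩) with hh
  have hmono : Monotone h := fun k l hkl => hx (by simp only [Fin.mk_le_mk]; omega)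
  refine ⟨fun k => h (k + 1) - h k, fun k => sub_nonneg.2 (hmono (Nat.le_succ k)), ?_⟩
  have key : ∀ i, ∑ k ∈ Finset.range (m + 1),
      (h (k + 1) - h k) * (if i ∈ chamberSet π k then (1 : ℝ) else 0) = f i - h 0 := by
    intro i
    have hlt := (π.symm i).2
    have h1 : h (π.symm i : ℕ) = f i := by
      have : (⟨min (π.symm i : ℕ) m, by omega⟩ : Fin (m + 1)) = π.symm i := by
        ext; simp only; omega
      simp only [hh, this, Equiv.apply_symm_apply]
    rw [← h1, ← Finset.sum_range_sub]
    simp only [mul_ite, mul_one, mul_zero]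
    rw [← Finset.sum_filter]
    refine Finset.sum_congr ?_ fun _ _ => rfl
    ext k
    simp only [chamberSet, Finset.mem_filter, Finset.mem_univ, true_and, Finset.mem_range]
    omega
  refine braid_ext fun i j => ?_
  simp only [map_sum, map_smul, coordDiff_indicatorClass, smul_eq_mul, mul_sub,
    Finset.sum_sub_distrib, coordDiff_toBraid] at key ⊢
  have e1 := key i
  have e2 := key j
  simp only [sub_mul, Finset.sum_sub_distrib] at e1 e2 ⊢
  linarith

theorem exists_mem_weylChamber (x : BraidSpace n) : ∃ π, x ∈ weylChamber π := by
  obtain ⟨f, rfl⟩ := toBraid_surjective x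
  exact ⟨Tuple.sort f, mem_weylChamber_toBraid.2 (Tuple.monotone_sort f)⟩

theorem exists_chamber_of_chain (C : Finset (Finset (Fin n)))
    (hC : ∀ S ∈ C, ∀ T ∈ C, S ⊆ T ∨ T ⊆ S) :
    ∃ π, ∀ S ∈ C, indicatorClass S ∈ weylChamber π := by
  -- Sort points by the number of members of the chain containing them. A point of `S` lies in every
  -- member above `S`, so it precedes no point outside `S`.
  set f : Fin n → ℕ := fun i => (C.filter (i ∈ ·)).card with hf
  refine ⟨Tuple.sort f, fun S hS => mem_weylChamber_toBraid.2 fun i j hij => ?_⟩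
  have h : f (Tuple.sort f i) ≤ f (Tuple.sort f j) := Tuple.monotone_sort f hij
  simp only [Function.comp]
  by_cases hp : Tuple.sort f i ∈ S
  · have hq : Tuple.sort f j ∈ S := by
      by_contra hq
      refine absurd h (not_le.2 (Finset.card_lt_card (Finset.ssubset_iff_of_subset ?_ |>.2
        ⟨S, Finset.mem_filter.2 ⟨hS, hp⟩, fun hS' => hq (Finset.mem_filter.1 hS').2⟩)))
      intro T hT
      rw [Finset.mem_filter] at hT ⊢
      rcases hC S hS T hT.1 with hST | hTS
      · exact ⟨hT.1, hST hp⟩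
      · exact absurd (hTS hT.2) hq
    rw [if_pos hp, if_pos hq]
  · rw [if_neg hp]
    split_ifs <;> norm_num

/-- A point with pairwise distinct coordinates is an interior point of its chamber. -/
theorem exists_sub_smul_mem {π : Equiv.Perm (Fin n)} {x : BraidSpace n}
    (hx : ∀ i j, i < j → 0 < coordDiff (π i) (π j) x) (y : BraidSpace n) :
    ∃ ε : ℝ, 0 < ε ∧ x - ε • y ∈ weylChamber π := by
  have h : ∀ i j, ∀ᶠ ε in nhdsWithin (0 : ℝ) (Set.Ioi 0),
      i < j → 0 < coordDiff (π i) (π j) (x - ε • y) := by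
    intro i j
    by_cases hij : i < j
    · have hc : Continuous fun ε : ℝ => coordDiff (π i) (π j) (x - ε • y) := by
        simp only [map_sub, map_smul, smul_eq_mul]
        fun_prop
      have h0 : 0 < coordDiff (π i) (π j) (x - (0 : ℝ) • y) := by simpa using hx i j hij
      filter_upwards [(hc.tendsto 0).eventually_const_lt h0 |>.filter_mono
        nhdsWithin_le_nhds] with ε hε _ using hε
    · exact Filter.Eventually.of_forall fun _ h => absurd h hij
  have h' := (Filter.eventually_all.2 fun i => Filter.eventually_all.2 (h i)).and
    (self_mem_nhdsWithin : Set.Ioi (0 : ℝ) ∈ _)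
  obtain ⟨ε, h1, h2⟩ := h'.exists
  refine ⟨ε, h2, fun i j hij => ?_⟩
  rcases hij.eq_or_lt with rfl | hij
  · obtain ⟨f, hf⟩ := toBraid_surjective (x - ε • y)
    rw [← hf, coordDiff_toBraid, sub_self]
  · exact (h1 i j hij).le

theorem exists_interior_point (π : Equiv.Perm (Fin n)) :
    ∃ x ∈ weylChamber π, ∀ i j, i < j → 0 < coordDiff (π i) (π j) x := by
  refine ⟨toBraid n fun i => ((π.symm i : ℕ) : ℝ), mem_weylChamber_toBraid.2 fun i j hij => ?_,
    fun i j hij => ?_⟩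
  · simpa using hij
  · simpa using hij

theorem span_eq_top_of_weylChamber_le {π : Equiv.Perm (Fin n)} {s : Set (BraidSpace n)}
    (h : weylChamber π ≤ PointedCone.hull ℝ s) : Submodule.span ℝ s = ⊤ := by
  rw [eq_top_iff]
  intro y _
  obtain ⟨x, hx, hx'⟩ := exists_interior_point π
  obtain ⟨ε, hε, hy⟩ := exists_sub_smul_mem hx' y
  have h1 : x ∈ Submodule.span ℝ s := PointedCone.hull_le_span (R := ℝ) s (h hx)
  have h2 : x - ε • y ∈ Submodule.span ℝ s := PointedCone.hull_le_span (R := ℝ) s (h hy)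
  have h3 := Submodule.smul_mem _ ε⁻¹ (Submodule.sub_mem _ h1 h2)
  rwa [sub_sub_cancel, smul_smul, inv_mul_cancel₀ hε.ne', one_smul] at h3

/-- An interior point makes `π'⁻¹ ∘ π` strictly increasing, and `Fin n` has no order automorphism
but the identity. -/
theorem eq_of_weylChamber_le {π π' : Equiv.Perm (Fin n)} (h : weylChamber π ≤ weylChamber π') :
    π = π' := by
  obtain ⟨x, hx, hx'⟩ := exists_interior_point π
  obtain ⟨f, rfl⟩ := toBraid_surjective x
  have h1 : StrictMono (f ∘ π) := fun i j hij => sub_pos.1 (hx' i j hij)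
  have h2 : Monotone (f ∘ π') := mem_weylChamber_toBraid.1 (h hx)
  have h3 : StrictMono (π'.symm ∘ π) := by
    intro i j hij
    by_contra hle
    have := h2 (not_lt.1 hle)
    simp only [Function.comp, Equiv.apply_symm_apply] at this
    exact absurd (h1 hij) (not_lt.2 this)
  have h4 := Subsingleton.elim (h3.orderIsoOfSurjective _ (by
    exact π'.symm.surjective.comp π.surjective)) (OrderIso.refl (Fin n))
  ext i
  have h5 : π'.symm (π i) = i := congrArg (fun e : Fin n ≃o Fin n => e i) h4
  rw [Equiv.symm_apply_eq] at h5
  rw [h5]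

end Braid

/-! ### Integral versus real independence in the braid lattice -/

variable {n : ℕ}

theorem finrank_braidSpace (m : ℕ) : Module.finrank ℝ (BraidSpace (m + 1)) = m := by
  have h := (Submodule.span ℝ {(1 : Fin (m + 1) → ℝ)}).finrank_quotient_add_finrank
  rw [finrank_span_singleton one_ne_zero, Module.finrank_fin_fun] at h
  exact Nat.add_right_cancel h

/-- The classes of the vectors `e_1, …, e_m` generate the lattice `ℤ^{m+1} / ℤ e`. -/
theorem braidLattice_le_span (m : ℕ) : braidLattice (m + 1) ≤ Submodule.span ℤ
    (Set.range fun i : Fin m => indicatorClass {i.succ}) := by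
  rintro _ ⟨z, rfl⟩
  have : integerClass (m + 1) z =
      ∑ i : Fin m, (z i.succ - z 0) • indicatorClass {i.succ} := by
    have h0 : ∀ j : Fin (m + 1), ∑ i : Fin m, ((z i.succ : ℝ) - z 0) *
        (if j ∈ ({i.succ} : Finset (Fin (m + 1))) then 1 else 0) = z j - z 0 := by
      intro j
      simp only [Finset.mem_singleton, mul_ite, mul_one, mul_zero]
      refine Fin.cases ?_ (fun k => ?_) j
      · rw [sub_self]
        exact Finset.sum_eq_zero fun i _ => if_neg (Fin.succ_ne_zero i).symm
      · simp
    refine braid_ext fun i j => ?_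
    simp only [map_sum, map_zsmul, coordDiff_indicatorClass, zsmul_eq_mul, Int.cast_sub, mul_sub,
      Finset.sum_sub_distrib, h0]
    change (z j : ℝ) - z i = _
    ring
  rw [this]
  exact Submodule.sum_mem _ fun i _ => Submodule.smul_mem _ _
    (Submodule.subset_span ⟨i, rfl⟩)

theorem span_braidLattice : Submodule.span ℝ (braidLattice n : Set (BraidSpace n)) = ⊤ := by
  rw [eq_top_iff]
  have h : weylChamber (1 : Equiv.Perm (Fin n)) ≤
      PointedCone.hull ℝ (braidLattice n : Set (BraidSpace n)) := by
    intro x hx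
    obtain ⟨a, ha, rfl⟩ := exists_sum_of_mem_weylChamber hx
    exact Submodule.sum_mem _ fun k _ => PointedCone.smul_mem _ (ha k)
      (PointedCone.subset_hull (indicatorClass_mem_lattice _))
  exact (span_eq_top_of_weylChamber_le h).ge

/-- Smoothness gives independence over `ℤ` only. In rank `m` this bounds the size of `B` by `m`, and
a spanning set of that size in an `m`-dimensional real space is independent. -/
theorem isLatticeBasis_of_linearIndepOn_int {B : Set (BraidSpace n)}
    (hB : LinearIndepOn ℤ id B) (hspan : Submodule.span ℤ B = braidLattice n) :
    IsLatticeBasis (braidLattice n) B := by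
  refine ⟨?_, hspan⟩
  rcases n with _ | m
  · have : B = ∅ := by
      rw [Set.eq_empty_iff_forall_notMem]
      intro x hx
      have hx0 : x = 0 := braid_ext fun i => i.elim0
      exact hB.zero_notMem_image ⟨x, hx, hx0⟩
    rw [this]
    exact linearIndepOn_empty ℝ id
  · have hle : Set.range (fun b : B => (b : BraidSpace (m + 1))) ≤ Submodule.span ℤ
        (Set.range fun i : Fin m => indicatorClass {i.succ}) := by
      rintro _ ⟨b, rfl⟩
      refine braidLattice_le_span m ?_
      rw [← hspan]
      exact Submodule.subset_span b.2
    have := Fintype.ofFinite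
      (Set.range fun i : Fin m => indicatorClass ({i.succ} : Finset (Fin (m + 1))))
    have hfin : Finite B := LinearIndependent.finite_of_le_span_finite _ hB _ hle
    have := Fintype.ofFinite B
    have hcard := linearIndependent_le_span_aux' _ hB _ hle
    refine linearIndependent_of_top_le_span_of_card_le_finrank ?_ ?_
    · have h1 : Set.range (fun b : B => id (b : BraidSpace (m + 1))) = B := by simp
      rw [h1, ← span_braidLattice, ← hspan]
      refine Submodule.span_le.2 fun x hx => ?_
      exact Submodule.span_le_restrictScalars ℤ ℝ B hx
    · rw [finrank_braidSpace]
      refine hcard.trans ?_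
      rw [← Nat.card_eq_fintype_card]
      exact (Finite.card_range_le _).trans_eq (Nat.card_fin m)

/-! ### Rays and walls of fans refined by the braid fan -/

section Coarsening

variable {F : Set (PointedCone ℝ (BraidSpace n))}

/-- Expand `v` in the indicator classes of a chamber containing it. The ray is a face of a cone
containing this chamber, so it absorbs every class that occurs. -/
theorem exists_indicatorClass_mem_ray (hF : IsFan (braidLattice n) F)
    (hW : ∀ π, ∃ σ ∈ F, weylChamber π ≤ σ) {σ : PointedCone ℝ (BraidSpace n)} (hσ : σ ∈ F)
    {v : BraidSpace n} (hv0 : v ≠ 0) (hv : (PointedCone.hull ℝ {v}).IsFaceOf σ) :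
    ∃ S, indicatorClass S ≠ 0 ∧ indicatorClass S ∈ PointedCone.hull ℝ {v} := by
  obtain ⟨π, hπ⟩ := exists_mem_weylChamber v
  obtain ⟨σ', hσ', hπσ'⟩ := hW π
  have hvσ' : PointedCone.hull ℝ {v} ≤ σ' := Submodule.span_le.2 (by simpa using hπσ' hπ)
  have hf := isFaceOf_of_le hF (hF.face_mem σ hσ _ hv) hσ' hvσ'
  obtain ⟨a, ha, hsum⟩ := exists_sum_of_mem_weylChamber hπ
  have hex : ∃ k ∈ Finset.range n, a k • indicatorClass (chamberSet π k) ≠ 0 := by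
    by_contra! h
    exact hv0 (hsum ▸ Finset.sum_eq_zero h)
  obtain ⟨k, hk, hne⟩ := hex
  refine ⟨chamberSet π k, (smul_ne_zero_iff.1 hne).2, ?_⟩
  refine mem_face_of_sum_mem hf (f := fun k => indicatorClass (chamberSet π k))
    (fun i _ => hπσ' (indicatorClass_chamberSet_mem π i)) (fun i _ => ha i) ?_ hk
    (smul_ne_zero_iff.1 hne).1
  rw [hsum]
  exact PointedCone.subset_hull rfl

theorem exists_eq_indicatorClass (hF : IsFan (braidLattice n) F)
    (hW : ∀ π, ∃ σ ∈ F, weylChamber π ≤ σ) {σ : PointedCone ℝ (BraidSpace n)} (hσ : σ ∈ F)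
    {v : BraidSpace n} (hv : v ∈ rayGens (braidLattice n) σ) : ∃ S, v = indicatorClass S := by
  obtain ⟨S, hS, hSv⟩ := exists_indicatorClass_mem_ray hF hW hσ hv.2.1 hv.2.2.1
  exact ⟨S, (eq_of_primitive hv.1 (indicatorClass_mem_lattice S) hS hv.2.2.2
    (fun t => indicatorClass_primitive hS) hSv).symm⟩

theorem eq_hull_rayGens (hF : IsFan (braidLattice n) F)
    (hW : ∀ π, ∃ σ ∈ F, weylChamber π ≤ σ) {σ : PointedCone ℝ (BraidSpace n)} (hσ : σ ∈ F) :
    σ = PointedCone.hull ℝ (rayGens (braidLattice n) σ) := by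
  refine le_antisymm ?_ (Submodule.span_le.2 fun v hv =>
    hv.2.2.1.le (PointedCone.subset_hull rfl))
  obtain ⟨t, -, ht, hext⟩ := (hF.rational σ hσ).exists_extremal
  nth_rewrite 1 [ht]
  refine Submodule.span_le.2 fun v hv => ?_
  obtain ⟨hv0, hvf⟩ := hext v hv
  obtain ⟨S, hS, hSv⟩ := exists_indicatorClass_mem_ray hF hW hσ hv0 hvf
  obtain ⟨r, hr, hr'⟩ := mem_hull_singleton.1 hSv
  have hr0 : r ≠ 0 := by
    rintro rfl
    exact hS (by rw [hr', zero_smul])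
  have hvS : v = r⁻¹ • indicatorClass S := by
    rw [hr', smul_smul, inv_mul_cancel₀ hr0, one_smul]
  have hle : PointedCone.hull ℝ {indicatorClass S} = PointedCone.hull ℝ {v} := by
    refine le_antisymm (Submodule.span_le.2 (by simpa using hSv)) (Submodule.span_le.2 ?_)
    rw [Set.singleton_subset_iff]
    exact mem_hull_singleton.2 ⟨r⁻¹, inv_nonneg.2 hr, hvS⟩
  have hSray : indicatorClass S ∈ rayGens (braidLattice n) σ :=
    ⟨indicatorClass_mem_lattice S, hS, hle ▸ hvf, fun t => indicatorClass_primitive hS⟩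
  rw [hvS]
  exact PointedCone.smul_mem _ (inv_nonneg.2 hr) (PointedCone.subset_hull hSray)

/-- A fan with regular cones that is refined by the braid fan. -/
structure IsBraidCoarsening (F : Set (PointedCone ℝ (BraidSpace n))) : Prop
    extends IsRegularFan (braidLattice n) F where
  chamber_le : ∀ π, ∃ σ ∈ F, weylChamber π ≤ σ

theorem isBraidCoarsening_of_isSmooth (hF : IsFan (braidLattice n) F)
    (hs : IsSmooth (braidLattice n) F) (hr : Refines (braidFan n) F) : IsBraidCoarsening F := by
  have hW : ∀ π, ∃ σ ∈ F, weylChamber π ≤ σ := fun π =>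
    hr.2 _ ⟨π, PointedCone.IsFaceOf.refl _⟩
  refine ⟨⟨hF, fun σ hσ => ?_⟩, hW⟩
  obtain ⟨B, hσB, hB, hspan⟩ := hs σ hσ
  have hb := isLatticeBasis_of_linearIndepOn_int hB hspan
  have hfin : (rayGens (braidLattice n) σ).Finite :=
    (LinearIndependent.setFinite hb.1).subset hσB
  refine ⟨hfin.toFinset, B, by simpa using hσB, hb, ?_⟩
  rw [Set.Finite.coe_toFinset]
  exact eq_hull_rayGens hF hW hσ

theorem IsRegularFan.isStarPair {V : Type*} [AddCommGroup V] [Module ℝ V] {N : Submodule ℤ V}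
    {F : Set (PointedCone ℝ V)} (hF : IsRegularFan N F) {σ : PointedCone ℝ V} (hσ : σ ∈ F)
    {u v : V} (hu : u ∈ rayGens N σ) (hv : v ∈ rayGens N σ) (huv : u ≠ v) :
    IsStarPair N F u v := by
  classical
  obtain ⟨G, B, hG, hB, rfl⟩ := hF.gens σ hσ
  rw [rayGens_hull hB hG] at hu hv
  have hs : ({u, v} : Finset V) ⊆ G := by
    intro x hx
    rw [Finset.mem_insert, Finset.mem_singleton] at hx
    rcases hx with rfl | rfl
    exacts [hu, hv]
  have h1 := hF.face_mem _ hσ _ (isFaceOf_hull hB.1 hG hs)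
  have h2 := rayGens_hull hB (G := {u, v}) (fun x hx => hG (hs hx))
  rw [Finset.coe_pair] at h1 h2
  exact ⟨h1, huv, h2⟩

namespace IsBraidCoarsening

variable (hF : IsBraidCoarsening F)
include hF

/-- For crossing sets, `A ∩ C` and `A ∪ C` form a chain, so their classes lie in one chamber and in
one cone `σ'`. Their sum is `e_A + e_C`, so the face property puts `e_(A∩C)` in the cone over `e_A`
and `e_C`, which coordinates exclude. -/
theorem nested {σ : PointedCone ℝ (BraidSpace n)} (hσ : σ ∈ F) {A C : Finset (Fin n)}
    (hA : indicatorClass A ∈ rayGens (braidLattice n) σ)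
    (hC : indicatorClass C ∈ rayGens (braidLattice n) σ) :
    A ⊆ C ∨ C ⊆ A ∨ Disjoint A C ∨ A ∪ C = Finset.univ := by
  by_contra! h
  obtain ⟨h1, h2, h3, h4⟩ := h
  obtain ⟨p, hpA, hpC⟩ := Finset.not_subset.1 h1
  obtain ⟨q, hqC, hqA⟩ := Finset.not_subset.1 h2
  obtain ⟨r, hrA, hrC⟩ := Finset.not_disjoint_iff.1 h3
  obtain ⟨s, hs⟩ : ∃ s, s ∉ A ∪ C := by
    by_contra! h
    exact h4 (Finset.eq_univ_of_forall h)
  rw [Finset.mem_union, not_or] at hs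
  have hne : indicatorClass A ≠ indicatorClass C := fun e =>
    h1 (indicatorClass_subset hA.2.1 e)
  have hpair := (hF.isStarPair hσ hA hC hne).mem
  obtain ⟨π, hπ⟩ := exists_chamber_of_chain {A ∩ C, A ∪ C} (by
    have : A ∩ C ⊆ A ∪ C := Finset.inter_subset_union
    intro S hS T hT
    simp only [Finset.mem_insert, Finset.mem_singleton] at hS hT
    rcases hS with rfl | rfl <;> rcases hT with rfl | rfl <;> simp [this])
  obtain ⟨σ', hσ', hle⟩ := hF.chamber_le π
  have hi := hle (hπ (A ∩ C) (by simp))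
  have hu := hle (hπ (A ∪ C) (by simp))
  have hf := (hF.inter_face _ hpair _ hσ').2
  have hmem : indicatorClass (A ∩ C) + indicatorClass (A ∪ C) ∈
      PointedCone.hull ℝ {indicatorClass A, indicatorClass C} ⊓ σ' := by
    refine ⟨?_, Submodule.add_mem _ hi hu⟩
    rw [← indicatorClass_add]
    exact add_mem_pair_hull
  have h5 := (hf.mem_of_add_mem_left hi hu hmem).1
  obtain ⟨a, b, hab⟩ := Submodule.mem_span_pair.1 h5
  change (a : ℝ) • indicatorClass A + (b : ℝ) • indicatorClass C = _ at hab
  have key : ∀ i, (a : ℝ) * (coordDiff s i (indicatorClass A)) +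
      (b : ℝ) * (coordDiff s i (indicatorClass C)) = coordDiff s i (indicatorClass (A ∩ C)) := by
    intro i
    rw [← hab, map_add, map_smul, map_smul]
    rfl
  -- Relative to `s`, the points `p`, `q`, `r` give `a = 0`, `b = 0` and `a + b = 1`.
  have e1 := key p
  have e2 := key q
  have e3 := key r
  simp only [coordDiff_indicatorClass, Finset.mem_inter, hs.1, hs.2, hpA, hpC, hqA, hqC, hrA, hrC,
    if_true, if_false, and_true, and_false] at e1 e2 e3
  linarith

theorem exists_separating {σ : PointedCone ℝ (BraidSpace n)} (hσ : σ ∈ F)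
    {π : Equiv.Perm (Fin n)} (hπ : weylChamber π ≤ σ) {i j : Fin n} (hij : i ≠ j) :
    ∃ S, indicatorClass S ∈ rayGens (braidLattice n) σ ∧ ¬ (i ∈ S ↔ j ∈ S) := by
  by_contra! h
  obtain ⟨G, B, hG, hB, rfl⟩ := hF.gens σ hσ
  have hspan := span_eq_top_of_weylChamber_le hπ
  have hle : Submodule.span ℝ (G : Set (BraidSpace n)) ≤ LinearMap.ker (coordDiff i j) := by
    refine Submodule.span_le.2 fun g hg => ?_
    have hg' : g ∈ rayGens (braidLattice n) (PointedCone.hull ℝ (G : Set (BraidSpace n))) := by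
      rwa [rayGens_hull hB hG]
    obtain ⟨S, rfl⟩ := exists_eq_indicatorClass hF.toIsFan hF.chamber_le hσ hg'
    have := h S hg'
    change coordDiff i j _ = 0
    rw [coordDiff_indicatorClass]
    simp [this]
  rw [hspan] at hle
  have h1 : coordDiff i j (indicatorClass {j}) = 0 := hle Submodule.mem_top
  rw [coordDiff_indicatorClass] at h1
  simp [hij] at h1

/-- The facet of `σ` opposite to a ray lies in a hyperplane `x_i = x_j`. -/
theorem exists_wall {σ : PointedCone ℝ (BraidSpace n)} (hσ : σ ∈ F)
    {π : Equiv.Perm (Fin n)} (hπ : weylChamber π ≤ σ) {A : Finset (Fin n)}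
    (hA : indicatorClass A ∈ rayGens (braidLattice n) σ) :
    ∃ i j, i ∉ A ∧ j ∈ A ∧ ∀ S, indicatorClass S ∈ rayGens (braidLattice n) σ → S ≠ A →
      (i ∈ S ↔ j ∈ S) := by
  classical
  set R : Finset (Finset (Fin n)) := (Finset.univ.filter fun S =>
    indicatorClass S ∈ rayGens (braidLattice n) σ).erase A with hR
  have hRmem : ∀ S ∈ R, S ≠ A ∧ indicatorClass S ∈ rayGens (braidLattice n) σ := by
    intro S hS
    rwa [hR, Finset.mem_erase, Finset.mem_filter, and_iff_right (Finset.mem_univ S)] at hS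
  set enc : Finset (Fin n) → ℕ := fun S => (Fintype.equivFin _ S : ℕ) with henc
  have henc_inj : Function.Injective enc :=
    Fin.val_injective.comp (Fintype.equivFin _).injective
  -- By uniqueness of binary expansions, `f i` records which members of `R` contain `i`. Up to a
  -- constant, `f` is also the coordinate vector of a point of the facet opposite to `e_A`.
  set f : Fin n → ℕ := fun i => ∑ S ∈ R.filter (i ∈ ·), 2 ^ enc S with hf
  have hf' : ∀ i j, f i = f j → ∀ S ∈ R, (i ∈ S ↔ j ∈ S) := by
    intro i j hij S hS
    have h1 : ∀ i, f i = ∑ k ∈ (R.filter (i ∈ ·)).image enc, 2 ^ k := fun i => by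
      rw [Finset.sum_image henc_inj.injOn]
    rw [h1, h1] at hij
    have h2 := Finset.image_injective henc_inj (Finset.geomSum_injective le_rfl hij)
    have h3 := Finset.ext_iff.1 h2 S
    simpa [hS] using h3
  -- If `f` were injective, that point of the facet would be interior to a chamber, and the facet
  -- would contain the whole chamber, hence span the space. A collision `f i = f j` gives the
  -- hyperplane.
  by_cases hinj : Function.Injective f
  · exfalso
    obtain ⟨G, B, hG, hB, rfl⟩ := hF.gens σ hσ
    rw [rayGens_hull hB hG] at hA hRmem
    have hfc := isFaceOf_hull hB.1 hG (G.erase_subset (indicatorClass A))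
    have hφF := hF.face_mem _ hσ _ hfc
    set φ := PointedCone.hull ℝ ((G.erase (indicatorClass A) : Finset _) : Set (BraidSpace n))
    set x : BraidSpace n := ∑ S ∈ R, (2 ^ enc S : ℝ) • indicatorClass S with hx
    have hxφ : x ∈ φ := by
      refine Submodule.sum_mem _ fun S hS => PointedCone.smul_mem _ (by positivity)
        (PointedCone.subset_hull ?_)
      obtain ⟨hSA, hSG⟩ := hRmem S hS
      refine Finset.mem_coe.2 (Finset.mem_erase.2 ⟨fun e => hSA ?_, hSG⟩)
      exact indicatorClass_injective (hB.ne_zero (hG hSG)) e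
    have hxf : ∀ i j, coordDiff i j x = (f j : ℝ) - f i := by
      intro i j
      simp only [hx, map_sum, map_smul, coordDiff_indicatorClass, smul_eq_mul, mul_sub, mul_ite,
        mul_one, mul_zero, Finset.sum_sub_distrib, hf, Finset.sum_filter]
      push_cast
      rfl
    set ρ := Tuple.sort f
    have hρ : ∀ i j, i < j → 0 < coordDiff (ρ i) (ρ j) x := by
      intro i j hij
      rw [hxf, sub_pos]
      have h1 : f (ρ i) ≤ f (ρ j) := Tuple.monotone_sort f hij.le
      have h2 : f (ρ i) ≠ f (ρ j) := fun e => hij.ne (ρ.injective (hinj e))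
      exact_mod_cast lt_of_le_of_ne h1 h2
    obtain ⟨σ', hσ', hle⟩ := hF.chamber_le ρ
    have hface := (hF.inter_face _ hφF _ hσ').2
    have hxσ' : x ∈ σ' := by
      obtain ⟨ε, hε, h⟩ := exists_sub_smul_mem hρ 0
      simpa using hle h
    have hσφ : σ' ≤ φ := by
      intro y hy
      obtain ⟨ε, hε, h⟩ := exists_sub_smul_mem hρ y
      refine (hface.mem_of_smul_add_mem hy (hle h) hε ?_).1
      rw [add_sub_cancel]
      exact ⟨hxφ, hxσ'⟩
    have hspan := span_eq_top_of_weylChamber_le (hle.trans hσφ)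
    obtain ⟨c, hc⟩ := exists_isDualFamily hB.1
    have hker : Submodule.span ℝ ((G.erase (indicatorClass A) : Finset _) : Set (BraidSpace n)) ≤
        LinearMap.ker (c (indicatorClass A)) := by
      refine Submodule.span_le.2 fun g hg => ?_
      rw [Finset.mem_coe, Finset.mem_erase] at hg
      exact (hc _ (hG hA)).2 g (hG hg.2) hg.1
    rw [hspan] at hker
    have h1 : c (indicatorClass A) (indicatorClass A) = 0 := hker Submodule.mem_top
    rw [(hc _ (hG hA)).1] at h1
    exact one_ne_zero h1
  · rw [Function.Injective] at hinj
    push Not at hinj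
    obtain ⟨i, j, hij, hne⟩ := hinj
    have hsame : ∀ S, indicatorClass S ∈ rayGens (braidLattice n) σ → S ≠ A →
        (i ∈ S ↔ j ∈ S) := fun S hS hSA => hf' i j hij S (by simp [hR, hS, hSA])
    obtain ⟨S, hS, hsep⟩ := hF.exists_separating hσ hπ hne
    have hSA : S = A := by
      by_contra h
      exact hsep (hsame S hS h)
    subst hSA
    by_cases hi : i ∈ S
    · have hj : j ∉ S := fun hj => hsep (iff_of_true hi hj)
      exact ⟨j, i, hj, hi, fun T hT hTS => (hsame T hT hTS).symm⟩
    · have hj : j ∈ S := by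
        by_contra hj
        exact hsep (iff_of_false hi hj)
      exact ⟨i, j, hi, hj, hsame⟩

/-- Both sides are linear and agree on the generators: `A` alone separates `i` from `j`. Comparing
dual coordinates thereby becomes comparing coordinates `x_i`. -/
theorem coord_eq_coordDiff {B : Set (BraidSpace n)} (hB : IsLatticeBasis (braidLattice n) B)
    {c : BraidSpace n → BraidSpace n →ₗ[ℝ] ℝ} (hc : IsDualFamily B c)
    {G : Finset (BraidSpace n)} (hG : (G : Set (BraidSpace n)) ⊆ B)
    (hσ : PointedCone.hull ℝ (G : Set (BraidSpace n)) ∈ F) {A : Finset (Fin n)}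
    (hA : indicatorClass A ∈ G) {i j : Fin n} (hi : i ∉ A) (hj : j ∈ A)
    (hij : ∀ S, indicatorClass S ∈ G → S ≠ A → (i ∈ S ↔ j ∈ S)) {x : BraidSpace n}
    (hx : x ∈ PointedCone.hull ℝ (G : Set (BraidSpace n))) :
    c (indicatorClass A) x = coordDiff i j x := by
  conv_rhs => rw [← hc.sum_eq hG hx]
  rw [map_sum, Finset.sum_eq_single_of_mem _ hA]
  · rw [map_smul, coordDiff_indicatorClass, if_pos hj, if_neg hi, sub_zero, smul_eq_mul, mul_one]
  · intro g hg hgA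
    have hg' : g ∈ rayGens (braidLattice n) (PointedCone.hull ℝ (G : Set (BraidSpace n))) := by
      rwa [rayGens_hull hB hG]
    obtain ⟨S, rfl⟩ := exists_eq_indicatorClass hF.toIsFan hF.chamber_le hσ hg'
    have := hij S hg (fun e => hgA (e ▸ rfl))
    rw [map_smul, coordDiff_indicatorClass]
    simp [this]

end IsBraidCoarsening

end Coarsening

/-! ### Incomparable pairs with maximal symmetric difference -/

section Combinatorics

open scoped symmDiff

/-- Two sets neither of which contains the other. -/
def Incomparable (A B : Finset (Fin n)) : Prop := ¬ A ⊆ B ∧ ¬ B ⊆ A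

theorem Incomparable.compl {A B : Finset (Fin n)} (h : Incomparable A B) :
    Incomparable Aᶜ Bᶜ := by
  rw [Incomparable, Finset.compl_subset_compl, Finset.compl_subset_compl]
  exact h.symm

/-- A family of sets that are pairwise nested, disjoint or covering. -/
def IsNestedFamily (P : Finset (Fin n) → Prop) : Prop :=
  ∀ A C, P A → P C → A ⊆ C ∨ C ⊆ A ∨ Disjoint A C ∨ A ∪ C = Finset.univ

/-- The points `i ∉ A` and `j ∈ A` are separated by `A`, but by no other member of the family. -/
structure IsWall (P : Finset (Fin n) → Prop) (A : Finset (Fin n)) (i j : Fin n) : Prop where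
  notMem : i ∉ A
  mem : j ∈ A
  iff : ∀ S, P S → S ≠ A → (i ∈ S ↔ j ∈ S)

/-- Suppose `C` contains `i₁` but not `i₂`. The wall conditions put `j₁` inside `C` and `j₂`
outside, and nestedness yields `A ⊂ C` (strictly, by `i₁`) with `C` disjoint from `B`. Then `C`, `B`
is an incomparable pair with `|C| + |B| > |A| + |B|`, against maximality. -/
theorem mem_of_separating {P : Finset (Fin n) → Prop} (hP : IsNestedFamily P)
    {A B C : Finset (Fin n)} (hA : P A) (hB : P B) (hC : P C) (hAB : Disjoint A B)
    (hmax : ∀ A' B', P A' → P B' → Incomparable A' B' → (A' ∆ B').card ≤ (A ∆ B).card)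
    {i₁ j₁ i₂ j₂ : Fin n} (h₁ : IsWall P A i₁ j₁) (h₂ : IsWall P B i₂ j₂) (hi : i₁ ∈ C) :
    i₂ ∈ C := by
  by_contra hi'
  have hj₁B : j₁ ∉ B := Finset.disjoint_left.1 hAB h₁.mem
  have hj₂A : j₂ ∉ A := Finset.disjoint_right.1 hAB h₂.mem
  have hBA : B ≠ A := fun e => hj₁B (e ▸ h₁.mem)
  have hi₁B : i₁ ∉ B := fun h => hj₁B ((h₁.iff B hB hBA).1 h)
  have hi₂A : i₂ ∉ A := fun h => hj₂A ((h₂.iff A hA hBA.symm).1 h)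
  have hCA : C ≠ A := fun e => h₁.notMem (e ▸ hi)
  have hCB : C ≠ B := fun e => hi₁B (e ▸ hi)
  have hj₁C : j₁ ∈ C := (h₁.iff C hC hCA).1 hi
  have hj₂C : j₂ ∉ C := fun h => hi' ((h₂.iff C hC hCB).2 h)
  have hAC : A ⊆ C := by
    rcases hP A C hA hC with h | h | h | h
    · exact h
    · exact absurd (h hi) h₁.notMem
    · exact absurd hj₁C (Finset.disjoint_left.1 h h₁.mem)
    · have : i₂ ∈ A ∪ C := h ▸ Finset.mem_univ _
      rcases Finset.mem_union.1 this with h | h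
      exacts [absurd h hi₂A, absurd h hi']
  have hCBd : Disjoint C B := by
    rcases hP C B hC hB with h | h | h | h
    · exact absurd (h hi) hi₁B
    · exact absurd (h h₂.mem) hj₂C
    · exact h
    · have : i₂ ∈ C ∪ B := h ▸ Finset.mem_univ _
      rcases Finset.mem_union.1 this with h | h
      exacts [absurd h hi', absurd h h₂.notMem]
  have hle := hmax C B hC hB ⟨fun h => hi₁B (h hi), fun h => hj₂C (h h₂.mem)⟩
  rw [hCBd.symmDiff_eq_sup, hAB.symmDiff_eq_sup, Finset.sup_eq_union, Finset.sup_eq_union,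
    Finset.card_union_of_disjoint hCBd, Finset.card_union_of_disjoint hAB] at hle
  have hlt : A.card < C.card := Finset.card_lt_card
    ((Finset.ssubset_iff_of_subset hAC).2 ⟨i₁, hi, h₁.notMem⟩)
  omega

theorem eq_of_disjoint {P : Finset (Fin n) → Prop} (hP : IsNestedFamily P)
    (hsep : ∀ i j, i ≠ j → ∃ S, P S ∧ ¬ (i ∈ S ↔ j ∈ S))
    {A B : Finset (Fin n)} (hA : P A) (hB : P B) (hAB : Disjoint A B)
    (hmax : ∀ A' B', P A' → P B' → Incomparable A' B' → (A' ∆ B').card ≤ (A ∆ B).card)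
    {i₁ j₁ i₂ j₂ : Fin n} (h₁ : IsWall P A i₁ j₁) (h₂ : IsWall P B i₂ j₂) : i₁ = i₂ := by
  by_contra hne
  obtain ⟨C, hC, hi⟩ := hsep _ _ hne
  refine hi ⟨mem_of_separating hP hA hB hC hAB hmax h₁ h₂,
    mem_of_separating hP hB hA hC hAB.symm ?_ h₂ h₁⟩
  rwa [symmDiff_comm]

theorem IsWall.compl {P : Finset (Fin n) → Prop} {A : Finset (Fin n)} {i j : Fin n}
    (h : IsWall P A i j) : IsWall (fun S => P Sᶜ) Aᶜ j i := by
  refine ⟨by simpa using h.mem, by simpa using h.notMem, fun S hS hSA => ?_⟩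
  have := h.iff Sᶜ hS (fun e => hSA (by rw [← e, compl_compl]))
  rw [Finset.mem_compl, Finset.mem_compl, not_iff_not] at this
  exact this.symm

/-- Taking complements turns covering pairs into disjoint ones, swaps the two points of a wall and
preserves symmetric differences. -/
theorem eq_of_union_eq_univ {P : Finset (Fin n) → Prop} (hP : IsNestedFamily P)
    (hsep : ∀ i j, i ≠ j → ∃ S, P S ∧ ¬ (i ∈ S ↔ j ∈ S))
    {A B : Finset (Fin n)} (hA : P A) (hB : P B) (hAB : A ∪ B = Finset.univ)
    (hmax : ∀ A' B', P A' → P B' → Incomparable A' B' → (A' ∆ B').card ≤ (A ∆ B).card)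
    {i₁ j₁ i₂ j₂ : Fin n} (h₁ : IsWall P A i₁ j₁) (h₂ : IsWall P B i₂ j₂) : j₁ = j₂ := by
  refine eq_of_disjoint (P := fun S => P Sᶜ) (A := Aᶜ) (B := Bᶜ) ?_ ?_ ?_ ?_ ?_ ?_
    h₁.compl h₂.compl
  · intro S T hS hT
    have := hP _ _ hS hT
    rw [Finset.compl_subset_compl, Finset.compl_subset_compl, ← Finset.compl_inter,
      Finset.compl_eq_univ_iff, ← Finset.disjoint_iff_inter_eq_empty] at this
    rcases this with h | h | h | h
    · exact Or.inr (Or.inl h)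
    · exact Or.inl h
    · refine Or.inr (Or.inr (Or.inr ?_))
      rw [Finset.disjoint_iff_inter_eq_empty, ← Finset.compl_union] at h
      exact Finset.compl_eq_empty_iff _ |>.1 h
    · exact Or.inr (Or.inr (Or.inl h))
  · intro i j hij
    obtain ⟨S, hS, h⟩ := hsep i j hij
    refine ⟨Sᶜ, by rwa [compl_compl], ?_⟩
    rwa [Finset.mem_compl, Finset.mem_compl, not_iff_not]
  · rwa [compl_compl]
  · rwa [compl_compl]
  · rw [Finset.disjoint_iff_inter_eq_empty, ← Finset.compl_union, hAB, Finset.compl_univ]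
  · intro A' B' hA' hB' hinc
    rw [compl_symmDiff_compl]
    have := hmax _ _ hA' hB' hinc.compl
    rwa [compl_symmDiff_compl] at this

end Combinatorics

/-! ### Subdividing down to the braid fan -/

section Factorization

open scoped symmDiff

variable {F : Set (PointedCone ℝ (BraidSpace n))}

/-- The pairs of incomparable sets whose classes are the ray generators of a cone of `F`. -/
def IsIncomparablePair (F : Set (PointedCone ℝ (BraidSpace n))) (A B : Finset (Fin n)) : Prop :=
  Incomparable A B ∧ IsStarPair (braidLattice n) F (indicatorClass A) (indicatorClass B)

theorem weylChamber_total (π : Equiv.Perm (Fin n)) (i j : Fin n) :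
    (∀ x ∈ weylChamber π, 0 ≤ coordDiff i j x) ∨ ∀ x ∈ weylChamber π, 0 ≤ coordDiff j i x := by
  rcases le_total (π.symm i) (π.symm j) with h | h
  · left
    intro x hx
    simpa using hx _ _ h
  · right
    intro x hx
    simpa using hx _ _ h

namespace IsBraidCoarsening

variable (hF : IsBraidCoarsening F)
include hF

theorem isIncomparablePair {σ : PointedCone ℝ (BraidSpace n)} (hσ : σ ∈ F)
    {A B : Finset (Fin n)} (hA : indicatorClass A ∈ rayGens (braidLattice n) σ)
    (hB : indicatorClass B ∈ rayGens (braidLattice n) σ) (hAB : Incomparable A B) :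
    IsIncomparablePair F A B :=
  ⟨hAB, hF.isStarPair hσ hA hB fun e => hAB.1 (indicatorClass_subset hA.2.1 e)⟩

/-- Only chambers in a cone containing both rays need attention. There the two halves are separated
by comparing the coordinates of `e_A` and `e_B`, and maximality turns this into comparing two of the
`x_i`, whose order is constant on a chamber. -/
theorem isBraidCoarsening_starSubdivision {A B : Finset (Fin n)} (hAB : IsIncomparablePair F A B)
    (hmax : ∀ A' B', IsIncomparablePair F A' B' → (A' ∆ B').card ≤ (A ∆ B).card) :
    IsBraidCoarsening (starSubdivision (braidLattice n) F
      (PointedCone.hull ℝ {indicatorClass A, indicatorClass B})) := by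
  obtain ⟨hinc, hpair⟩ := hAB
  refine ⟨hpair.isRegularFan_starSubdivision hF.toIsRegularFan, fun π => ?_⟩
  obtain ⟨σ, hσ, hπ⟩ := hF.chamber_le π
  by_cases hτ : PointedCone.hull ℝ {indicatorClass A, indicatorClass B} ≤ σ
  swap
  · exact ⟨σ, Or.inl ⟨hσ, hτ⟩, hπ⟩
  set P : Finset (Fin n) → Prop := fun S =>
    indicatorClass S ∈ rayGens (braidLattice n) σ with hPdef
  have hrays := hpair.subset_rayGens hF.toIsRegularFan hσ hτ
  have hA : P A := hrays (by simp)
  have hB : P B := hrays (by simp)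
  have hP : IsNestedFamily P := fun S T hS hT => hF.nested hσ hS hT
  have hmax' : ∀ A' B', P A' → P B' → Incomparable A' B' → (A' ∆ B').card ≤ (A ∆ B).card :=
    fun A' B' hA' hB' h => hmax A' B' (hF.isIncomparablePair hσ hA' hB' h)
  have hsep : ∀ i j, i ≠ j → ∃ S, P S ∧ ¬ (i ∈ S ↔ j ∈ S) :=
    fun i j hij => hF.exists_separating hσ hπ hij
  obtain ⟨i₁, j₁, hi₁, hj₁, hw₁⟩ := hF.exists_wall hσ hπ hA
  obtain ⟨i₂, j₂, hi₂, hj₂, hw₂⟩ := hF.exists_wall hσ hπ hB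
  have w₁ : IsWall P A i₁ j₁ := ⟨hi₁, hj₁, hw₁⟩
  have w₂ : IsWall P B i₂ j₂ := ⟨hi₂, hj₂, hw₂⟩
  obtain ⟨G, L, hG, hL, rfl⟩ := hF.gens σ hσ
  obtain ⟨c, hc⟩ := exists_isDualFamily hL.1
  simp only [hPdef, rayGens_hull hL hG] at hA hB hw₁ hw₂
  have hcA := fun x hx => hF.coord_eq_coordDiff hL hc hG hσ hA hi₁ hj₁ hw₁ (x := x) hx
  have hcB := fun x hx => hF.coord_eq_coordDiff hL hc hG hσ hB hi₂ hj₂ hw₂ (x := x) hx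
  have hsign : (∀ x ∈ weylChamber π, c (indicatorClass A) x ≤ c (indicatorClass B) x) ∨
      ∀ x ∈ weylChamber π, c (indicatorClass B) x ≤ c (indicatorClass A) x := by
    -- A shared endpoint cancels in the difference of the two coordinates and leaves a single
    -- difference of two of the `x_i`.
    have hdisj : i₁ = i₂ ∨ j₁ = j₂ := by
      rcases hP A B (hrays (by simp)) (hrays (by simp)) with h | h | h | h
      · exact absurd h hinc.1
      · exact absurd h hinc.2
      · exact Or.inl (eq_of_disjoint hP hsep (hrays (by simp)) (hrays (by simp)) h hmax' w₁ w₂)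
      · exact Or.inr
          (eq_of_union_eq_univ hP hsep (hrays (by simp)) (hrays (by simp)) h hmax' w₁ w₂)
    have hdiff : ∀ (x : BraidSpace n) (i j k : Fin n),
        coordDiff i j x - coordDiff i k x = coordDiff k j x ∧
        coordDiff j i x - coordDiff k i x = coordDiff j k x := by
      intro x i j k
      obtain ⟨f, rfl⟩ := toBraid_surjective x
      simp only [coordDiff_toBraid]
      constructor <;> ring
    rcases hdisj with rfl | rfl
    · refine (weylChamber_total π j₁ j₂).imp (fun h x hx => ?_) (fun h x hx => ?_)
      · rw [hcA x (hπ hx), hcB x (hπ hx), ← sub_nonneg, (hdiff x i₁ j₂ j₁).1]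
        exact h x hx
      · rw [hcA x (hπ hx), hcB x (hπ hx), ← sub_nonneg, (hdiff x i₁ j₁ j₂).1]
        exact h x hx
    · refine (weylChamber_total π i₂ i₁).imp (fun h x hx => ?_) (fun h x hx => ?_)
      · rw [hcA x (hπ hx), hcB x (hπ hx), ← sub_nonneg, (hdiff x j₁ i₂ i₁).2]
        exact h x hx
      · rw [hcA x (hπ hx), hcB x (hπ hx), ← sub_nonneg, (hdiff x j₁ i₁ i₂).2]
        exact h x hx
  rcases hsign with h | h
  · obtain ⟨κ, hκ, hle⟩ := hpair.exists_mem_half hF.toIsRegularFan hL hc hG hσ hτ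
    exact ⟨κ, hκ, fun x hx => hle x (hπ hx) (h x hx)⟩
  · rw [Set.pair_comm] at hτ ⊢
    obtain ⟨κ, hκ, hle⟩ := hpair.symm.exists_mem_half hF.toIsRegularFan hL hc hG hσ hτ
    exact ⟨κ, hκ, fun x hx => hle x (hπ hx) (h x hx)⟩

/-- Each cone comes from a chain of sets, so it lies in a chamber. Hence a cone containing a chamber
is squeezed between two chambers, which must coincide. -/
theorem eq_braidFan (h : ∀ A B, ¬ IsIncomparablePair F A B) : F = braidFan n := by
  classical
  have hle : ∀ σ ∈ F, ∃ π, σ ≤ weylChamber π := by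
    intro σ hσ
    obtain ⟨π, hπ⟩ := exists_chamber_of_chain
      (Finset.univ.filter fun S => indicatorClass S ∈ rayGens (braidLattice n) σ) (by
        intro S hS T hT
        by_contra! hST
        exact h S T (hF.isIncomparablePair hσ (Finset.mem_filter.1 hS).2
          (Finset.mem_filter.1 hT).2 hST))
    refine ⟨π, ?_⟩
    rw [eq_hull_rayGens hF.toIsFan hF.chamber_le hσ]
    refine Submodule.span_le.2 fun v hv => ?_
    obtain ⟨S, rfl⟩ := exists_eq_indicatorClass hF.toIsFan hF.chamber_le hσ hv
    exact hπ S (Finset.mem_filter.2 ⟨Finset.mem_univ _, hv⟩)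
  have hmem : ∀ π, weylChamber π ∈ F := by
    intro π
    obtain ⟨σ, hσ, hπσ⟩ := hF.chamber_le π
    obtain ⟨π', hσπ'⟩ := hle σ hσ
    obtain rfl := eq_of_weylChamber_le (hπσ.trans hσπ')
    rwa [hπσ.antisymm hσπ']
  ext σ
  constructor
  · intro hσ
    obtain ⟨π, hπ⟩ := hle σ hσ
    exact ⟨π, isFaceOf_of_le hF.toIsFan hσ (hmem π) hπ⟩
  · rintro ⟨π, hπ⟩
    exact hF.face_mem _ (hmem π) _ hπ

end IsBraidCoarsening

open Classical in
/-- The sets whose classes span a ray of `F`. -/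
noncomputable def raySets (F : Set (PointedCone ℝ (BraidSpace n))) : Finset (Finset (Fin n)) :=
  Finset.univ.filter fun S => indicatorClass S ≠ 0 ∧ PointedCone.hull ℝ {indicatorClass S} ∈ F

theorem mem_raySets {S : Finset (Fin n)} : S ∈ raySets F ↔
    indicatorClass S ≠ 0 ∧ PointedCone.hull ℝ {indicatorClass S} ∈ F := by
  simp [raySets]

/-- Strict growth inside a finite set gives termination. The new ray is again that of an indicator
class, because the union or the intersection of the pair has class zero. -/
theorem IsBraidCoarsening.raySets_ssubset (hF : IsBraidCoarsening F) {A B : Finset (Fin n)}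
    (hAB : IsIncomparablePair F A B) :
    raySets F ⊂ raySets (starSubdivision (braidLattice n) F
      (PointedCone.hull ℝ {indicatorClass A, indicatorClass B})) := by
  obtain ⟨hinc, hpair⟩ := hAB
  obtain ⟨T, hT⟩ : ∃ T, indicatorClass A + indicatorClass B = indicatorClass T := by
    have hrays := hpair.rayGens_eq
    have hempty : indicatorClass (∅ : Finset (Fin n)) = 0 :=
      braid_ext fun i j => by simp [coordDiff_indicatorClass]
    have huniv : indicatorClass (Finset.univ : Finset (Fin n)) = 0 :=
      braid_ext fun i j => by simp [coordDiff_indicatorClass]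
    rw [indicatorClass_add]
    rcases hF.nested hpair.mem (A := A) (C := B) (by rw [hrays]; simp) (by rw [hrays]; simp)
      with h | h | h | h
    · exact absurd h hinc.1
    · exact absurd h hinc.2
    · exact ⟨A ∪ B, by rw [Finset.disjoint_iff_inter_eq_empty.1 h, hempty, zero_add]⟩
    · exact ⟨A ∩ B, by rw [h, huniv, add_zero]⟩
  have hT0 : indicatorClass T ≠ 0 := hT ▸ hpair.add_ne_zero hF.toIsRegularFan
  refine (Finset.ssubset_iff_of_subset fun S hS => ?_).2 ⟨T, ?_, fun h => ?_⟩
  · rw [mem_raySets] at hS ⊢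
    exact ⟨hS.1, Or.inl ⟨hS.2, hpair.not_le_hull_singleton _⟩⟩
  · rw [mem_raySets, ← hT]
    exact ⟨hT ▸ hT0, hpair.hull_add_mem_starSubdivision hF.toIsRegularFan⟩
  · rw [mem_raySets, ← hT] at h
    exact hpair.hull_add_notMem hF.toIsRegularFan h.2

/-- Induction on the number of subsets that do not span a ray. That the braid fan is a fan comes for
free, since the process ends at a fan equal to it. -/
theorem IsBraidCoarsening.reflTransGen (hF : IsBraidCoarsening F) :
    Relation.ReflTransGen (IsSmoothStarSubdivision (braidLattice n)) F (braidFan n) ∧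
      IsFan (braidLattice n) (braidFan n) := by
  classical
  induction hk : (raySets F)ᶜ.card using Nat.strong_induction_on generalizing F with
  | _ k ih =>
    by_cases h : ∃ p : Finset (Fin n) × Finset (Fin n), IsIncomparablePair F p.1 p.2
    · obtain ⟨⟨A, B⟩, hAB, hmax⟩ := Finset.exists_max_image
        (Finset.univ.filter fun p : Finset (Fin n) × Finset (Fin n) =>
          IsIncomparablePair F p.1 p.2) (fun p => (p.1 ∆ p.2).card)
        (by obtain ⟨p, hp⟩ := h; exact ⟨p, by simpa using hp⟩)
      rw [Finset.mem_filter] at hAB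
      have hF' := hF.isBraidCoarsening_starSubdivision hAB.2 fun A' B' h' =>
        hmax (A', B') (Finset.mem_filter.2 ⟨Finset.mem_univ _, h'⟩)
      have hlt := Finset.card_lt_card
        (Finset.compl_ssubset_compl.2 (hF.raySets_ssubset hAB.2))
      obtain ⟨h1, h2⟩ := ih _ (hk ▸ hlt) hF' rfl
      exact ⟨Relation.ReflTransGen.head
        (hAB.2.2.isSmoothStarSubdivision hF.toIsRegularFan) h1, h2⟩
    · push Not at h
      have := hF.eq_braidFan fun A B => h (A, B)
      subst this
      exact ⟨Relation.ReflTransGen.refl, hF.toIsFan⟩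

end Factorization

end ToricFan

theorem corollary3p2 (n : ℕ)
    (F₁ F₂ : Set (PointedCone ℝ (ToricFan.BraidSpace n)))
    (hF₁ : ToricFan.IsFan (ToricFan.braidLattice n) F₁)
    (hF₂ : ToricFan.IsFan (ToricFan.braidLattice n) F₂)
    (smooth₁ : ToricFan.IsSmooth (ToricFan.braidLattice n) F₁)
    (smooth₂ : ToricFan.IsSmooth (ToricFan.braidLattice n) F₂)
    (complete₁ : ToricFan.IsComplete F₁)
    (complete₂ : ToricFan.IsComplete F₂)
    (refined₁ : ToricFan.Refines (ToricFan.braidFan n) F₁)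
    (refined₂ : ToricFan.Refines (ToricFan.braidFan n) F₂) :
    (∃ F₃ : Set (PointedCone ℝ (ToricFan.BraidSpace n)),
      ToricFan.IsStrongFactorization (ToricFan.braidLattice n) F₁ F₂ F₃) ∧
    ToricFan.IsStrongFactorization (ToricFan.braidLattice n) F₁ F₂ (ToricFan.braidFan n) := by
  have h₁ := (ToricFan.isBraidCoarsening_of_isSmooth hF₁ smooth₁ refined₁).reflTransGen
  have h₂ := (ToricFan.isBraidCoarsening_of_isSmooth hF₂ smooth₂ refined₂).reflTransGen
  have h : ToricFan.IsStrongFactorization (ToricFan.braidLattice n) F₁ F₂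
      (ToricFan.braidFan n) := ⟨h₁.2, h₁.1, h₂.1⟩
  exact ⟨⟨_, h⟩, h⟩
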